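/- Work with smooth real differential functions: a differential function of $q_1,\dots,q_N$ on an open subset $U$ of the infinite jet space with coordinates $q_i^{(k)}$ ($1\le i\le N$, $k\ge 0$) is a smooth function on $U$ of finitely many jet coordinates, $f_x=\sum_{i,k}q_i^{(k+1)}\,\partial f/\partial q_i^{(k)}$ is the total derivative, $E_i(f)=\sum_k(-d/dx)^k\,\partial f/\partial q_i^{(k)}$ is the Euler–Lagrange operator, and for vector fields $X,Y$ (tuples of differential functions) $[X,Y]=X'[Y]-Y'[X]$, where $X'[Y]$ is the directional derivative of $X$ in the direction of $Y$. For $n\ge 1$ and $q=(q_1,\dots,q_n)$ put $q_0=1$ and $q_i=0$ for $i>n$. Let $L$ be the $n\times n$ matrix with first column $(-q_1,\dots,-q_n)^T$, ones directly above the diagonal and zeros elsewhere; let $G^{(0)}$ have entries $q_{i+j-n-1}$ (zero if $i+j<n+1$), let $g^{(m)}=(L^mG^{(0)})^{-1}$, and let $K_1=I$, $K_{r+1}=LK_r+q_rI$. Let the potentials $V_r^{(k)}$, $k\in\mathbf Z$, be given by $V_r^{(0)}=\delta_{r,n}$, $V_r^{(k)}=V_{r+1}^{(k-1)}-q_rV_1^{(k-1)}$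 and, inversely, $V_r^{(k)}=V_{r-1}^{(k+1)}-\frac{q_{r-1}}{q_n}V_n^{(k+1)}$ for $1\le r\le n$, with $V_r^{(k)}=0$ for $r<1$ or $r>n$. Put $$Z_r^n[q]=K_r(q)\,q_x,\qquad \mathcal L^{n,m,k}=\tfrac12\,q_x^T g^{(m)}(q)\,q_x-V_1^{(k)}(q).$$ Let $\sigma\ge1$, $\alpha\ge0$, $s\ge1$ be integers and $N=\sigma+\alpha$. An elimination of $q_{N+1},\dots,q_n$ on an open set $U$ of the jet space of $q_1,\dots,q_N$ by a given set of equations consists of differential functions $f_{N+1},\dots,f_n$ of $q_1,\dots,q_N$ on $U$ such that the substitution $q_j=f_j[q_1,\dots,q_N]$, $j=N+1,\dots,n$, turns these equations into identities on $U$. The reduced vector field $\overline Z_r^{N}$ consists of the first $N$ components of $Z_r^n$ after this substitution. **Lemma (reduced fields commute).** 1. (Positive potentials.) Let $n=s+\sigma+\alpha-1$. The equations $E_i(\mathcal L^{n,0,2n+\sigma})=0$, $i=\sigma+1,\dots,n-\alpha$, admit an elimination of $q_{\sigma+\alpha+1},\dots,q_n$ on the whole jet space, and for every elimination by these equations (on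 any open $U$) the first $s$ reduced fields commute on $U$: $$[\overline Z_i^{\sigma+\alpha},\overline Z_j^{\sigma+\alpha}]=0,\qquad i,j=1,\dots,s.$$ 2. (Negative potentials.) Let $n=s+2(\sigma+\alpha)-1$. The equations $E_i(\mathcal L^{n,n-\sigma,-n})=0$, $i=1,\dots,n-\sigma-\alpha$, admit an elimination of $q_{\sigma+\alpha+1},\dots,q_n$ with $q_n\neq0$ everywhere on some non-empty open subset of the jet space, and for every elimination by these equations with $q_n\ne0$ everywhere (on any open $U$) the following $s$ reduced fields commute on $U$: $$[\overline Z_i^{\sigma+\alpha},\overline Z_j^{\sigma+\alpha}]=0,\qquad i,j=\sigma+\alpha+1,\dots,\sigma+\alpha+s.$$ The case $\alpha=0$ of 1 is the basic reduction to $\sigma$ components, with $n=s+\sigma-1$. -/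

import Mathlib

open scoped ContDiff

namespace KillingReduction

noncomputable section

/-! ### Differential functions on the jet space

Throughout, a field with 1-based number `j` in the mathematical notation has the index
`j - 1 : Fin n`; numbers of flows, invariants and potentials are 1-based natural numbers. -/

/-- The infinite jet space of `N` fields `q_1, …, q_N` of one variable `x`, with the product
topology: `u i k` is the coordinate of the `k`-th `x`-derivative of the field `q_{i+1}`. -/
abbrev Jet (N : ℕ) : Type := Fin N → ℕ → ℝ

/-- The jet coordinates of order less than `K`. -/
def truncJet {N : ℕ} (K : ℕ) (u : Jet N) : Fin N → Fin K → ℝ := fun i k => u i k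

/-- `f` is a differential function on `U`: a smooth function of finitely many jet
coordinates. -/
def IsDifferentialFunctionOn {N : ℕ} (U : Set (Jet N)) (f : Jet N → ℝ) : Prop :=
  ∃ (K : ℕ) (F : (Fin N → Fin K → ℝ) → ℝ),
    ContDiffOn ℝ ∞ F (truncJet K '' U) ∧ ∀ u ∈ U, f u = F (truncJet K u)

/-- The total derivative `d/dx`, i.e. `∑ q_i^{(k+1)} ∂/∂q_i^{(k)}`, written as the directional
derivative along the shifted jet. -/
def totalD {N : ℕ} (f : Jet N → ℝ) : Jet N → ℝ :=
  fun u => lineDeriv ℝ f u (fun i k => u i (k + 1))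

/-- The partial derivative `∂f/∂q_{i+1}^{(k)}`. -/
def jetPartial {N : ℕ} (i : Fin N) (k : ℕ) (f : Jet N → ℝ) : Jet N → ℝ :=
  fun u => lineDeriv ℝ f u (Pi.single i (Pi.single k 1))

/-- The Euler-Lagrange operator `E_{i+1}(f) = ∑_k (-d/dx)^k ∂f/∂q_{i+1}^{(k)}`. -/
def euler {N : ℕ} (i : Fin N) (f : Jet N → ℝ) : Jet N → ℝ :=
  fun u => ∑ᶠ k : ℕ, (-1) ^ k * (totalD^[k] (jetPartial i k f)) u

/-- The jet `(d/dx)^k e_i` of a tuple `e` of differential functions. -/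
def prolong {N n : ℕ} (e : Fin n → Jet N → ℝ) (u : Jet N) : Jet n :=
  fun i k => (totalD^[k] (e i)) u

/-- The commutator `[X, Y] = X'[Y] - Y'[X]` of (evolutionary) vector fields with differential
functions as components, where `X'[Y]` is the directional derivative of `X` in the direction
of `Y`. -/
def fieldCommutator {N : ℕ} (X Y : Fin N → Jet N → ℝ) : Fin N → Jet N → ℝ :=
  fun i u => lineDeriv ℝ (X i) u (prolong Y u) - lineDeriv ℝ (Y i) u (prolong X u)

/-! ### The Benenti class in Viète coordinates -/

/-- The Viète coordinate `q_i`, with `q_0 = 1` and `q_i = 0` for `i > n`. -/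
def qc {n : ℕ} (q : Fin n → ℝ) (i : ℕ) : ℝ :=
  if i = 0 then 1 else if h : i - 1 < n then q ⟨i - 1, h⟩ else 0

/-- The tensor `L`: first column `-q_1, …, -q_n`, ones above the diagonal. -/
def tensorL {n : ℕ} (q : Fin n → ℝ) : Matrix (Fin n) (Fin n) ℝ :=
  Matrix.of fun i j =>
    if (j : ℕ) = 0 then -q i else if (j : ℕ) = (i : ℕ) + 1 then 1 else 0

/-- The contravariant metric `G^{(0)}`, with (1-based) entries `q_{i+j-n-1}`, being zero above
the antidiagonal. -/
def metricG0 {n : ℕ} (q : Fin n → ℝ) : Matrix (Fin n) (Fin n) ℝ :=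
  Matrix.of fun i j =>
    if n ≤ (i : ℕ) + (j : ℕ) + 1 then qc q ((i : ℕ) + (j : ℕ) + 1 - n) else 0

/-- The covariant metric `g^{(m)}`, the inverse of `G^{(m)} = L^m G^{(0)}`. -/
def metric {n : ℕ} (m : ℤ) (q : Fin n → ℝ) : Matrix (Fin n) (Fin n) ℝ :=
  (tensorL q ^ m * metricG0 q)⁻¹

/-- The Killing tensors: `K_1 = I`, `K_{r+1} = L K_r + q_r I` (started from `K_0 = 0`, which
gives `K_1 = q_0 I = I`). -/
def killingTensor {n : ℕ} (q : Fin n → ℝ) : ℕ → Matrix (Fin n) (Fin n) ℝ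
  | 0 => 0
  | r + 1 => tensorL q * killingTensor q r + qc q r • (1 : Matrix (Fin n) (Fin n) ℝ)

/-- The potentials `V_r^{(k)}` for `k ≥ 0`:
`V_r^{(0)} = δ_{r,n}`, `V_r^{(k+1)} = V_{r+1}^{(k)} - q_r V_1^{(k)}`, zero unless `1 ≤ r ≤ n`. -/
def potentialUp {n : ℕ} (q : Fin n → ℝ) : ℕ → ℕ → ℝ
  | 0, r => if r = n then 1 else 0
  | k + 1, r =>
    if 1 ≤ r ∧ r ≤ n then potentialUp q k (r + 1) - qc q r * potentialUp q k 1 else 0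

/-- The potentials `V_r^{(-k)}` for `k ≥ 0`, by the inverse recursion
`V_r^{(-k-1)} = V_{r-1}^{(-k)} - (q_{r-1} / q_n) V_n^{(-k)}`, zero unless `1 ≤ r ≤ n`. -/
def potentialDown {n : ℕ} (q : Fin n → ℝ) : ℕ → ℕ → ℝ
  | 0, r => if r = n then 1 else 0
  | k + 1, r =>
    if 1 ≤ r ∧ r ≤ n then
      potentialDown q k (r - 1) - qc q (r - 1) / qc q n * potentialDown q k n
    else 0

/-- The separable potential `V_r^{(k)}`, `k ∈ ℤ`. -/
def potential {n : ℕ} (k : ℤ) (r : ℕ) (q : Fin n → ℝ) : ℝ :=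
  match k with
  | Int.ofNat k => potentialUp q k r
  | Int.negSucc k => potentialDown q (k + 1) r

/-- The Lagrangian density `𝓛^{n,m,k} = ½ q_xᵀ g^{(m)}(q) q_x - V_1^{(k)}(q)`. -/
def lagrangian (n : ℕ) (m k : ℤ) : Jet n → ℝ := fun u =>
  (1 / 2) * ∑ i, ∑ j, u i 1 * metric m (fun l => u l 0) i j * u j 1
    - potential k 1 (fun l => u l 0)

/-- The Killing vector field `Z_r^n[q] = K_r(q) q_x`. -/
def killingField (n r : ℕ) : Fin n → Jet n → ℝ := fun j u =>
  (killingTensor (fun l => u l 0) r).mulVec (fun l => u l 1) j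

/-! ### Elimination and reduction -/

/-- The differential functions `e` of `q_1, …, q_N` on the open set `U` eliminate
`q_{N+1}, …, q_n` by means of the equations `E_{i+1}(ℒ) = 0`, `i ∈ I`: one has `e_j = q_j` for
`j ≤ N`, and substituting `q_j = e_j[q_1, …, q_N]` for all `j ≤ n` turns these equations into
identities on `U`. The set `D` is the region of the Viète coordinates where `ℒ` is defined. -/
structure IsElimination {N n : ℕ} (ℒ : Jet n → ℝ) (D : Set (Fin n → ℝ)) (I : Set (Fin n))
    (U : Set (Jet N)) (e : Fin n → Jet N → ℝ) : Prop where
  isOpen : IsOpen U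
  differential : ∀ i, IsDifferentialFunctionOn U (e i)
  retained : ∀ (i : Fin N) (j : Fin n), (i : ℕ) = j → ∀ u ∈ U, e j u = u i 0
  mem_domain : ∀ u ∈ U, (fun i => e i u) ∈ D
  solves : ∀ i ∈ I, ∀ u ∈ U, euler i ℒ (prolong e u) = 0

/-- Elimination for positive potentials: `q_{σ+α+1}, …, q_n` are eliminated by means of
`E_i(𝓛^{n,0,2n+σ}) = 0`, `i = σ+1, …, n-α`. -/
def IsPositiveElimination (n σ α : ℕ) (U : Set (Jet (σ + α)))
    (e : Fin n → Jet (σ + α) → ℝ) : Prop :=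
  IsElimination (lagrangian n 0 (2 * n + σ)) Set.univ
    {i | σ + 1 ≤ (i : ℕ) + 1 ∧ (i : ℕ) + 1 + α ≤ n} U e

/-- Elimination for negative potentials: `q_{σ+α+1}, …, q_n` are eliminated by means of
`E_i(𝓛^{n,n-σ,-n}) = 0`, `i = 1, …, n-σ-α`, where `q_n ≠ 0`. -/
def IsNegativeElimination (n σ α : ℕ) (U : Set (Jet (σ + α)))
    (e : Fin n → Jet (σ + α) → ℝ) : Prop :=
  IsElimination (lagrangian n (n - σ) (-n)) {q | qc q n ≠ 0}
    {i | (i : ℕ) + 1 + (σ + α) ≤ n} U e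

/-- The reduced vector field: the first `N` components of `Z_r^n` after the
substitution `q_j = e_j[q_1, …, q_N]`. -/
def reducedField {N n : ℕ} (h : N ≤ n) (e : Fin n → Jet N → ℝ) (r : ℕ) :
    Fin N → Jet N → ℝ :=
  fun j u => killingField n r (Fin.castLE h j) (prolong e u)

end

end KillingReduction

open KillingReduction

/-! Everything is encoded in the polynomial q(z) = 1 + q_1 z + … + q_n z^n, with d = d/dx acting on
coefficients. Write {a, b} = a b' - a' b (`wron`) and S(h) = (h')²/2 - h h'' (`quad`). By
`killingTensor_mulVec`, the flow δ of Z_r satisfies δ q_i = [z^(i+r-1)] {T, q}, where T is q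
truncated to degrees below r. By `euler_positive`, the Euler–Lagrange expressions of the positive
Lagrangian are coefficients of (1 + z^σ S(q)) / q².

Positive case. The equations say that 1 + z^σ S(q) ≡ w q² mod z^(n+1) with w a polynomial of degree
at most N = σ + α. Since σ ≥ 1, the exact equation 1 + z^σ S(h) = w h² has a unique power series
solution with given admissible h(0) (`exists_solution`, `solution_congr`), so q ≡ h mod z^(n+1). For
the truncation T of h, linearizing this equation along the defect z^a δh - {T, h}, a = r - 1, gives
(z^a δw - (T w' + 2 T' w + z^σ T''')) h² (`linearize`). The N prescribed components of δ make this
divisible by z^(N+a+1), while the first factor has degree at most N + a: it vanishes. Hence w obeys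
a closed flow, and the homogeneous linearized equation, solved order by order in z, makes the defect
vanish: z^a δh = {T, h} holds in all orders (`positive_flow`).

Exact flows of h give zero curvature equations for the truncations, again by comparing order and
degree (`zero_curvature`), and the Jacobi identity of {·, ·} then gives [δ₁, δ₂] h = 0
(`wron_jacobi_commutator`).

Negative case. The equations involve both ends of q: the reflection Q = z^n q(1/z) agrees mod
z^(n-N) with the solution h for a polynomial w of degree below σ, and w reflected is S(q)/q² mod
z^(σ+1). For r > N the part of q complementary to T consists of reflected coefficients of h. The
behaviour at z = 0 fixes the flow of w in its upper degrees and the solution h in its lower ones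
(`negative_flow`). The zero curvature equations, reflected back, yield commutation on q mod z^(N+1).

Analytically, differential functions form an algebra on which evolutionary fields act by derivations
commuting with d, which justifies the algebra above. Eliminations are built by solving the same
power series equation. -/

namespace KillingReduction

open PowerSeries TopologicalSpace

/-! ### Derivations acting on the coefficients of power series -/

section Algebra

variable {A : Type*} [CommRing A] [Algebra ℝ A]

/-- The coefficientwise action of a derivation on power series. -/
noncomputable def serD (D : Derivation ℝ A A) : Derivation ℝ A⟦X⟧ A⟦X⟧ :=
  Derivation.mk'
    { toFun := fun f => PowerSeries.mk fun n => D (coeff n f)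
      map_add' := fun f g => by ext n; simp
      map_smul' := fun c f => by
        ext n
        simp only [coeff_mk, RingHom.id_apply]
        rw [show coeff n (c • f) = c • coeff n f from rfl, D.map_smul]
        exact (congrArg (c • ·) (coeff_mk n (fun n => D (coeff n f)))).symm }
    (fun f g => by
      ext n
      simp only [LinearMap.coe_mk, AddHom.coe_mk, coeff_mk, coeff_mul, map_sum, D.leibniz,
        smul_eq_mul, map_add, Finset.sum_add_distrib]
      rw [Finset.Nat.sum_antidiagonal_swap
        (f := fun p => coeff p.1 g * D (coeff p.2 f)) |>.symm]
      simp)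

@[simp] theorem coeff_serD (D : Derivation ℝ A A) (n : ℕ) (f : A⟦X⟧) :
    coeff n (serD D f) = D (coeff n f) := by
  simp [serD]

theorem serD_X_pow (D : Derivation ℝ A A) (k : ℕ) : serD D (X ^ k : A⟦X⟧) = 0 := by
  ext n
  rw [coeff_serD, coeff_X_pow]
  split_ifs <;> simp

theorem serD_comm {D E : Derivation ℝ A A} (h : ∀ a, D (E a) = E (D a)) (f : A⟦X⟧) :
    serD D (serD E f) = serD E (serD D f) := by
  ext n; simp [h]

theorem X_pow_dvd_serD (D : Derivation ℝ A A) {k : ℕ} {f : A⟦X⟧} (h : X ^ k ∣ f) :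
    X ^ k ∣ serD D f := by
  rw [X_pow_dvd_iff] at h ⊢
  intro m hm
  simp [h m hm]

omit [Algebra ℝ A] in
theorem eq_zero_of_forall_X_pow_dvd {f : A⟦X⟧} (h : ∀ k, X ^ k ∣ f) : f = 0 := by
  ext n
  simpa using X_pow_dvd_iff.1 (h (n + 1)) n (Nat.lt_succ_self n)

theorem isUnit_two_series : IsUnit (2 : A⟦X⟧) := by
  have h : IsUnit (algebraMap ℝ A⟦X⟧ 2) := (isUnit_iff_ne_zero.2 two_ne_zero).map _
  rwa [map_ofNat] at h

/-! ### The quadratic expression and its linearization -/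

variable {B : Type*} [CommRing B] [Algebra ℝ B]

/-- The quadratic differential expression `(h')² / 2 - h h''`. -/
noncomputable def quad (d : Derivation ℝ B B) (h : B) : B :=
  (1 / 2 : ℝ) • (d h) ^ 2 - h * d (d h)

/-- The Wronskian bracket `a b' - a' b`. -/
noncomputable def wron (d : Derivation ℝ B B) (a b : B) : B := a * d b - d a * b

/-- The action of the vector field `T` on the potential `w`. -/
noncomputable def potentialFlow (d : Derivation ℝ B B) (c T w : B) : B :=
  T * d w + 2 * d T * w + c * d (d (d T))

theorem two_mul_quad (d : Derivation ℝ B B) (h : B) :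
    2 * quad d h = (d h) ^ 2 - 2 * h * d (d h) := by
  have : (2 : B) * ((1 / 2 : ℝ) • (d h) ^ 2) = (d h) ^ 2 := by
    rw [show (2 : B) = algebraMap ℝ B 2 from (map_ofNat _ 2).symm, ← Algebra.smul_def, smul_smul]
    norm_num
  rw [quad, mul_sub, this]; ring

theorem smul_half_cancel {a b : B} (h : 2 * a = 2 * b) : a = b := by
  have h2 : IsUnit (2 : B) := by
    have h : IsUnit (algebraMap ℝ B 2) := (isUnit_iff_ne_zero.2 two_ne_zero).map _
    rwa [map_ofNat] at h
  exact h2.mul_left_cancel h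

theorem deriv_quad (d δ : Derivation ℝ B B) (hc : ∀ x, δ (d x) = d (δ x)) (h : B) :
    δ (quad d h) = d h * d (δ h) - δ h * d (d h) - h * d (d (δ h)) := by
  apply smul_half_cancel
  have h1 : δ (2 * quad d h) = 2 * δ (quad d h) := by
    rw [δ.leibniz]
    have : δ (2 : B) = 0 := by exact_mod_cast δ.map_natCast 2
    simp [this]
  have h2 : δ (2 : B) = 0 := by exact_mod_cast δ.map_natCast 2
  rw [← h1, two_mul_quad]
  simp only [map_sub, pow_two, δ.leibniz, smul_eq_mul, hc, h2]
  ring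

/-- The expression `wron d T h` is the Lie derivative of h as a vector field along T, and
`potentialFlow` is the induced action on the projective connection w = (k + c S(h)) / h², whose
Schwarzian part gives the cocycle c T'''. Thus any failure of h to follow T is controlled by the
failure of w to do so. -/
theorem linearize (d δ : Derivation ℝ B B) (hc : ∀ x, δ (d x) = d (δ x)) {c k a h w : B} (T : B)
    (dc : d c = 0) (δc : δ c = 0) (dk : d k = 0) (δk : δ k = 0) (da : d a = 0)
    (heq : k + c * quad d h = w * h ^ 2) :
    c * (d h * d (a * δ h - wron d T h) - (a * δ h - wron d T h) * d (d h)
        - h * d (d (a * δ h - wron d T h)))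
      - 2 * w * h * (a * δ h - wron d T h)
      = (a * δ w - potentialFlow d c T w) * h ^ 2 := by
  have e1 := congrArg d heq
  have e2 := congrArg δ heq
  simp only [map_add, pow_two, Derivation.leibniz, smul_eq_mul, dc, δc, dk, δk,
    deriv_quad d δ hc, deriv_quad d d (fun _ => rfl)] at e1 e2
  simp only [wron, potentialFlow, map_sub, map_add, Derivation.leibniz, smul_eq_mul, da]
  simp only [map_zero]
  linear_combination a * e2 - T * e1

/-- Eliminating `T` against `h`: the potential flow along `h` itself vanishes. -/
theorem potentialFlow_self (d : Derivation ℝ B B) {c h w : B} (dc : d c = 0) (hu : IsUnit h)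
    (heq : 1 + c * quad d h = w * h ^ 2) : potentialFlow d c h w = 0 := by
  have e1 := congrArg d heq
  simp only [map_add, pow_two, Derivation.leibniz, smul_eq_mul, dc, Derivation.map_one_eq_zero,
    deriv_quad d d (fun _ => rfl)] at e1
  -- Since S(h)' = -h h''', the differentiated equation is, up to sign, h times the claim.
  apply hu.mul_left_cancel
  rw [potentialFlow]
  linear_combination -e1

theorem potentialFlow_sub (d : Derivation ℝ B B) (c S T w : B) :
    potentialFlow d c (S - T) w = potentialFlow d c S w - potentialFlow d c T w := by
  simp only [potentialFlow, map_sub]; ring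

/-- The Jacobi identity for the bracket a b' - a' b, with the zero curvature equation `hz` removing
the terms in which the flows differentiate T₁ and T₂. The errors e₁, e₂ are carried along because in
the negative case the flows of q are known only modulo a power of z. -/
theorem wron_jacobi_commutator (d δ₁ δ₂ : Derivation ℝ B B)
    (h₁ : ∀ x, δ₁ (d x) = d (δ₁ x)) (h₂ : ∀ x, δ₂ (d x) = d (δ₂ x)) {a₁ a₂ T₁ T₂ h : B}
    (d1 : d a₁ = 0) (d2 : d a₂ = 0) (d12 : δ₁ a₂ = 0) (d21 : δ₂ a₁ = 0)
    (hz : a₁ * δ₁ T₂ - a₂ * δ₂ T₁ = wron d T₁ T₂) {e₁ e₂ : B}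
    (f₁ : a₁ * δ₁ h = wron d T₁ h + e₁) (f₂ : a₂ * δ₂ h = wron d T₂ h + e₂) :
    a₁ * a₂ * (δ₁ (δ₂ h) - δ₂ (δ₁ h)) =
      wron d T₂ e₁ - wron d T₁ e₂ + a₁ * δ₁ e₂ - a₂ * δ₂ e₁ := by
  have g1 := congrArg δ₁ f₂
  have g2 := congrArg δ₂ f₁
  have k1 := congrArg d f₁
  have k2 := congrArg d f₂
  have hz' := congrArg d hz
  simp only [wron, map_add, map_sub, Derivation.leibniz, smul_eq_mul, d1, d2, d12, d21, h₁, h₂]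
    at g1 g2 k1 k2 hz' f₁ f₂ hz ⊢
  linear_combination a₁ * g1 - a₂ * g2 + hz * d h - hz' * h + T₂ * k1 - T₁ * k2
    - d T₂ * f₁ + d T₁ * f₂

end Algebra

/-! ### Solutions of the quadratic equation as power series -/

section Algebra

variable {A : Type*} [CommRing A]

/-- Banach's fixed point theorem in the z-adic topology: the coefficient of z^k no longer changes
from the iterate of index k + 1 on. -/
theorem exists_fixed_series (Φ : A⟦X⟧ → A⟦X⟧)
    (hΦ : ∀ k f g, X ^ k ∣ f - g → X ^ (k + 1) ∣ Φ f - Φ g) : ∃ g, Φ g = g := by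
  have step : ∀ k, X ^ k ∣ Φ^[k + 1] 0 - Φ^[k] 0 := by
    intro k
    induction k with
    | zero => simp
    | succ k ih =>
      rw [Function.iterate_succ_apply' Φ (k + 1), Function.iterate_succ_apply' Φ k]
      exact hΦ k _ _ (by rwa [Function.iterate_succ_apply' Φ k] at ih)
  have far : ∀ k l, X ^ k ∣ Φ^[k + l] 0 - Φ^[k] 0 := by
    intro k l
    induction l with
    | zero => simp
    | succ l ih =>
      have := (pow_dvd_pow (X : A⟦X⟧) (Nat.le_add_right k l)).trans (step (k + l))
      simpa [← add_assoc] using dvd_add this ih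
  set g : A⟦X⟧ := PowerSeries.mk fun k => coeff k (Φ^[k + 1] 0) with hg
  have near : ∀ k, X ^ k ∣ g - Φ^[k] 0 := by
    intro k
    rw [X_pow_dvd_iff]
    intro m hm
    have := X_pow_dvd_iff.1 (far (m + 1) (k - (m + 1))) m (Nat.lt_succ_self m)
    rw [Nat.add_sub_cancel' hm, map_sub, sub_eq_zero] at this
    simp [hg, this]
  refine ⟨g, ?_⟩
  rw [← sub_eq_zero]
  apply eq_zero_of_forall_X_pow_dvd
  intro k
  have h1 := (pow_dvd_pow (X : A⟦X⟧) (Nat.le_succ k)).trans (hΦ k _ _ (near k))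
  have h2 := (pow_dvd_pow (X : A⟦X⟧) (Nat.le_succ k)).trans (near (k + 1))
  rw [Function.iterate_succ_apply'] at h2
  have := dvd_sub h1 h2
  rwa [sub_sub_sub_cancel_right] at this

variable [Algebra ℝ A]

/-- The derivation acts on coefficients only and hence does not lower the order in z; so S is
non-expanding z-adically, despite containing derivatives. -/
theorem X_pow_dvd_quad_sub (D : Derivation ℝ A A) {k : ℕ} {f g : A⟦X⟧} (h : X ^ k ∣ f - g) :
    X ^ k ∣ quad (serD D) f - quad (serD D) g := by
  have h1 := X_pow_dvd_serD D h
  have h2 := X_pow_dvd_serD D h1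
  have key : 2 * (quad (serD D) f - quad (serD D) g) =
      (serD D (f - g)) * (serD D f + serD D g) - 2 * ((f - g) * serD D (serD D f))
        - 2 * (g * serD D (serD D (f - g))) := by
    rw [mul_sub, two_mul_quad, two_mul_quad]
    simp only [map_sub]; ring
  have : X ^ k ∣ 2 * (quad (serD D) f - quad (serD D) g) := by
    rw [key]
    exact dvd_sub (dvd_sub (h1.mul_right _) ((h.mul_right _).mul_left _))
      ((h2.mul_left _).mul_left _)
  exact (isUnit_two_series.dvd_mul_left).1 this

/-- Because σ ≥ 1, the differential term enters each order in z only through lower orders, so the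
equation is algebraically solvable coefficient by coefficient; at order 0 it is the hypothesis a²
w(0) = 1. -/
theorem exists_solution (D : Derivation ℝ A A) {σ : ℕ} (hσ : 1 ≤ σ) (w : A⟦X⟧) (a : A)
    (ha : a ^ 2 * constantCoeff w = 1) :
    ∃ h : A⟦X⟧, constantCoeff h = a ∧ 1 + X ^ σ * quad (serD D) h = w * h ^ 2 := by
  obtain ⟨τ, rfl⟩ : ∃ τ, σ = τ + 1 := ⟨σ - 1, by omega⟩
  have hu : IsUnit (2 * w * C a) := by
    rw [mul_assoc]
    refine isUnit_two_series.mul (isUnit_iff_constantCoeff.2 ?_)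
    refine IsUnit.of_mul_eq_one a ?_
    rw [map_mul, constantCoeff_C, ← ha]; ring
  obtain ⟨u, hu⟩ := hu.exists_right_inv
  obtain ⟨v, hv⟩ : X ∣ 1 - w * C a ^ 2 := by
    rw [X_dvd_iff]
    simp only [map_sub, map_mul, map_pow, constantCoeff_C, map_one]
    rw [← ha]; ring
  -- Substituting h = a + z g, subtracting the order 0 part z v and dividing by z leaves 2 w a g = v
  -- + z^(σ-1) S(a + z g) - z w g². The inverse u of 2 w a turns this into a fixed point problem,
  -- contracting even for σ = 1, since g enters S multiplied by z.
  set Φ : A⟦X⟧ → A⟦X⟧ := fun g =>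
    (v + X ^ τ * quad (serD D) (C a + X * g) - X * w * g ^ 2) * u with hΦ
  obtain ⟨g, hg⟩ := exists_fixed_series Φ (by
    intro k f g h
    have h1 : X ^ (k + 1) ∣ X * (f - g) := by
      rw [pow_succ']; exact mul_dvd_mul_left _ h
    have h2 := X_pow_dvd_quad_sub D (f := C a + X * f) (g := C a + X * g) (k := k + 1)
      (by rwa [add_sub_add_left_eq_sub, ← mul_sub])
    have : Φ f - Φ g = (X ^ τ * (quad (serD D) (C a + X * f) - quad (serD D) (C a + X * g))
      - X * (f - g) * (w * (f + g))) * u := by simp only [hΦ]; ring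
    rw [this]
    exact (dvd_sub (h2.mul_left _) (h1.mul_right _)).mul_right _)
  refine ⟨C a + X * g, by simp, ?_⟩
  have : g * (2 * w * C a) = v + X ^ τ * quad (serD D) (C a + X * g) - X * w * g ^ 2 := by
    conv_lhs => rw [← hg]
    simp only [hΦ]
    linear_combination (v + X ^ τ * quad (serD D) (C a + X * g) - X * w * g ^ 2) * hu
  linear_combination hv - X * this

/-- The difference of the two equations is w (h₁ + h₂)(h₁ - h₂) against z^σ times a non-expanding
term; the first factor is a unit, so each pass gains an order in z until m is reached. -/
theorem solution_congr (D : Derivation ℝ A A) {σ m : ℕ} (hσ : 1 ≤ σ) {w h₁ h₂ : A⟦X⟧}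
    (hw : IsUnit (w * h₁)) (h0 : X ∣ h₁ - h₂)
    (e₁ : X ^ m ∣ 1 + X ^ σ * quad (serD D) h₁ - w * h₁ ^ 2)
    (e₂ : X ^ m ∣ 1 + X ^ σ * quad (serD D) h₂ - w * h₂ ^ 2) :
    X ^ m ∣ h₁ - h₂ := by
  have hu : IsUnit (w * (h₁ + h₂)) := by
    rw [isUnit_iff_constantCoeff] at hw ⊢
    have : constantCoeff h₂ = constantCoeff h₁ := by
      rw [X_dvd_iff, map_sub, sub_eq_zero] at h0
      exact h0.symm
    rw [map_mul, map_add, this, ← two_mul, mul_left_comm, ← map_mul]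
    have h2 : IsUnit (2 : A) := by
      have h : IsUnit (algebraMap ℝ A 2) := (isUnit_iff_ne_zero.2 two_ne_zero).map _
      rwa [map_ofNat] at h
    exact h2.mul hw
  have key : ∀ k, k ≤ m → X ^ k ∣ h₁ - h₂ := by
    intro k
    induction k with
    | zero => simp
    | succ k ih =>
      intro hk
      have h1 := X_pow_dvd_quad_sub D (ih (by omega))
      have h2 : X ^ (k + 1) ∣ X ^ σ * (quad (serD D) h₁ - quad (serD D) h₂) := by
        rw [pow_succ']
        exact mul_dvd_mul (dvd_pow_self _ (by omega)) h1
      have h3 := (pow_dvd_pow (X : A⟦X⟧) hk).trans (dvd_sub e₁ e₂)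
      rw [← hu.dvd_mul_left]
      convert dvd_sub h2 h3 using 1
      ring
  exact key m le_rfl

/-- A flow of the potential lifts uniquely to a flow of the solution. -/
theorem flow_of_potentialFlow (D δ : Derivation ℝ A A) (hc : ∀ x, δ (D x) = D (δ x)) {σ a : ℕ}
    (hσ : 1 ≤ σ) {w h T : A⟦X⟧} (hw : IsUnit (w * h))
    (heq : 1 + X ^ σ * quad (serD D) h = w * h ^ 2)
    (hV : X ^ a * serD δ w = potentialFlow (serD D) (X ^ σ) T w) :
    X ^ a * serD δ h = wron (serD D) T h := by
  have lin := linearize (serD D) (serD δ) (serD_comm hc) (c := X ^ σ) (k := 1) (a := X ^ a) T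
    (serD_X_pow D σ) (serD_X_pow δ σ) (by simp) (by simp) (serD_X_pow D a) heq
  rw [hV, sub_self, zero_mul] at lin
  set E := X ^ a * serD δ h - wron (serD D) T h with hE
  rw [← sub_eq_zero, ← hE]
  apply eq_zero_of_forall_X_pow_dvd
  intro k
  induction k with
  | zero => simp
  | succ k ih =>
    have h1 := X_pow_dvd_serD D ih
    have h2 := X_pow_dvd_serD D h1
    -- The homogeneous linearized equation expresses 2 w h E as z^σ times terms linear in E and its
    -- derivatives; as σ ≥ 1, the order of E rises by one.
    rw [← (isUnit_two_series.mul hw).dvd_mul_left,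
      show 2 * (w * h) * E = X ^ σ * (serD D h * serD D E - E * serD D (serD D h)
        - h * serD D (serD D E)) by linear_combination -lin, pow_succ']
    exact mul_dvd_mul (dvd_pow_self _ (by omega))
      (dvd_sub (dvd_sub (h1.mul_left _) (ih.mul_right _)) (h2.mul_left _))

/-! ### Degrees and truncations -/

/-- The power series is a polynomial of degree less than `m`. -/
def DegLT (m : ℕ) (f : A⟦X⟧) : Prop := ∀ k, m ≤ k → coeff k f = 0

/-- The truncation as a power series. -/
noncomputable def cut (r : ℕ) (h : A⟦X⟧) : A⟦X⟧ :=
  PowerSeries.mk fun k => if k < r then coeff k h else 0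

omit [Algebra ℝ A] in
@[simp] theorem coeff_cut (k r : ℕ) (h : A⟦X⟧) :
    coeff k (cut r h) = if k < r then coeff k h else 0 := by simp [cut]

omit [Algebra ℝ A] in
theorem DegLT.cut (r : ℕ) (h : A⟦X⟧) : DegLT r (cut r h) := by
  intro k hk; simp [not_lt.2 hk]

omit [Algebra ℝ A] in
theorem DegLT.mono {m l : ℕ} {f : A⟦X⟧} (hf : DegLT m f) (h : m ≤ l) : DegLT l f :=
  fun k hk => hf k (h.trans hk)

omit [Algebra ℝ A] in
theorem DegLT.add {m : ℕ} {f g : A⟦X⟧} (hf : DegLT m f) (hg : DegLT m g) : DegLT m (f + g) := by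
  intro k hk; simp [hf k hk, hg k hk]

omit [Algebra ℝ A] in
theorem DegLT.sub {m : ℕ} {f g : A⟦X⟧} (hf : DegLT m f) (hg : DegLT m g) : DegLT m (f - g) := by
  intro k hk; simp [hf k hk, hg k hk]

omit [Algebra ℝ A] in
theorem DegLT.mul {m l p : ℕ} {f g : A⟦X⟧} (hf : DegLT m f) (hg : DegLT l g)
    (hp : m + l ≤ p + 1) : DegLT p (f * g) := by
  intro k hk
  rw [coeff_mul]
  apply Finset.sum_eq_zero
  rintro ⟨i, j⟩ hij
  rw [Finset.HasAntidiagonal.mem_antidiagonal] at hij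
  dsimp only at hij ⊢
  by_cases hi : m ≤ i
  · rw [hf i hi, zero_mul]
  · rw [hg j (by omega), mul_zero]

omit [Algebra ℝ A] in
theorem DegLT.X_pow (m : ℕ) : DegLT (m + 1) (X ^ m : A⟦X⟧) := by
  intro k hk
  rw [coeff_X_pow, if_neg (by omega)]

omit [Algebra ℝ A] in
theorem DegLT.two_mul {m : ℕ} {f : A⟦X⟧} (hf : DegLT m f) : DegLT m (2 * f) := by
  rw [_root_.two_mul]; exact hf.add hf

theorem DegLT.serD (D : Derivation ℝ A A) {m : ℕ} {f : A⟦X⟧} (hf : DegLT m f) :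
    DegLT m (serD D f) := by
  intro k hk; simp [hf k hk]

omit [Algebra ℝ A] in
theorem eq_zero_of_dvd_of_degLT {m : ℕ} {f : A⟦X⟧} (h : X ^ m ∣ f) (hf : DegLT m f) : f = 0 := by
  ext k
  rcases lt_or_ge k m with hk | hk
  · simpa using X_pow_dvd_iff.1 h k hk
  · simpa using hf k hk

omit [Algebra ℝ A] in
theorem X_pow_dvd_sub_cut (r : ℕ) (h : A⟦X⟧) : X ^ r ∣ h - cut r h := by
  rw [X_pow_dvd_iff]
  intro m hm; simp [hm]

theorem serD_cut (D : Derivation ℝ A A) (r : ℕ) (h : A⟦X⟧) :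
    serD D (cut r h) = cut r (serD D h) := by
  ext k
  rw [coeff_serD, coeff_cut, coeff_cut, coeff_serD]
  split_ifs <;> simp

theorem X_pow_dvd_wron (D : Derivation ℝ A A) {k l : ℕ} {f g : A⟦X⟧} (hf : X ^ k ∣ f)
    (hg : X ^ l ∣ g) : X ^ (k + l) ∣ wron (serD D) f g := by
  rw [wron, pow_add]
  exact dvd_sub (mul_dvd_mul hf (X_pow_dvd_serD D hg)) (mul_dvd_mul (X_pow_dvd_serD D hf) hg)

theorem X_pow_dvd_wron_left (D : Derivation ℝ A A) {k : ℕ} {f : A⟦X⟧} (hf : X ^ k ∣ f)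
    (g : A⟦X⟧) : X ^ k ∣ wron (serD D) f g :=
  dvd_sub (hf.mul_right _) ((X_pow_dvd_serD D hf).mul_right _)

theorem X_pow_dvd_wron_right (D : Derivation ℝ A A) {k : ℕ} {g : A⟦X⟧} (hg : X ^ k ∣ g)
    (f : A⟦X⟧) : X ^ k ∣ wron (serD D) f g :=
  dvd_sub ((X_pow_dvd_serD D hg).mul_left _) (hg.mul_left _)

theorem DegLT.wron (D : Derivation ℝ A A) {m l p : ℕ} {f g : A⟦X⟧} (hf : DegLT m f)
    (hg : DegLT l g) (hp : m + l ≤ p + 1) : DegLT p (wron (KillingReduction.serD D) f g) :=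
  (hf.mul (hg.serD D) hp).sub ((hf.serD D).mul hg hp)

theorem DegLT.potentialFlow (D : Derivation ℝ A A) {m l σ p : ℕ} {T w : A⟦X⟧} (hT : DegLT m T)
    (hw : DegLT l w) (hp : m + l ≤ p + 1) (hσ : m + σ ≤ p) :
    DegLT p (potentialFlow (KillingReduction.serD D) (X ^ σ) T w) :=
  ((hT.mul (hw.serD D) hp).add ((hT.serD D).two_mul.mul hw hp)).add
    ((DegLT.X_pow σ).mul (((hT.serD D).serD D).serD D) (by omega))

theorem X_pow_dvd_potentialFlow (D : Derivation ℝ A A) {k : ℕ} {c T : A⟦X⟧} (hT : X ^ k ∣ T)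
    (w : A⟦X⟧) : X ^ k ∣ potentialFlow (serD D) c T w := by
  have h1 := X_pow_dvd_serD D hT
  have h3 := X_pow_dvd_serD D (X_pow_dvd_serD D h1)
  exact dvd_add (dvd_add (hT.mul_right _) ((h1.mul_left _).mul_right _)) (h3.mul_left _)

/-- The action along h itself vanishes, so the action along the truncation is minus the action along
the tail of h, which starts at z^r. -/
theorem X_pow_dvd_potentialFlow_cut (D : Derivation ℝ A A) {σ : ℕ} {w h : A⟦X⟧} (hu : IsUnit h)
    (heq : 1 + X ^ σ * quad (serD D) h = w * h ^ 2) (r : ℕ) :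
    X ^ r ∣ potentialFlow (serD D) (X ^ σ) (cut r h) w := by
  have h1 := potentialFlow_self (serD D) (serD_X_pow D σ) hu heq
  have h2 := potentialFlow_sub (serD D) (X ^ σ) h (cut r h) w
  rw [h1, zero_sub] at h2
  rw [← dvd_neg, ← h2]
  exact X_pow_dvd_potentialFlow D (X_pow_dvd_sub_cut r h) w

/-- The zero curvature equations of the truncations. -/
theorem zero_curvature (D δ₁ δ₂ : Derivation ℝ A A) {a₁ a₂ r₁ r₂ : ℕ} {h : A⟦X⟧}
    (ha : a₁ + r₂ = a₂ + r₁) (hr₁ : a₁ ≤ r₁) (hr₂ : r₁ ≤ a₁ + 1)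
    (f₁ : X ^ a₁ * serD δ₁ h = wron (serD D) (cut r₁ h) h)
    (f₂ : X ^ a₂ * serD δ₂ h = wron (serD D) (cut r₂ h) h) :
    X ^ a₁ * serD δ₁ (cut r₂ h) - X ^ a₂ * serD δ₂ (cut r₁ h) =
      wron (serD D) (cut r₁ h) (cut r₂ h) := by
  rw [← sub_eq_zero]
  -- Order: the flows of h rewrite the expression through the tails of h, all terms being divisible
  -- by z^(a₁+r₂); the bracket of two tails needs a₁ ≤ r₁. Degree: every term has degree below a₁ +
  -- r₂; the bracket of two truncations needs r₁ ≤ a₁ + 1. The two admissible values of r₁ serve the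
  -- positive and the negative case.
  refine eq_zero_of_dvd_of_degLT (m := a₁ + r₂) ?_ ?_
  · have h1 := X_pow_dvd_sub_cut r₁ h
    have h2 := X_pow_dvd_sub_cut r₂ h
    have k1 : X ^ (a₁ + r₂) ∣ X ^ a₁ * serD δ₁ (h - cut r₂ h) := by
      rw [pow_add]; exact mul_dvd_mul_left _ (X_pow_dvd_serD _ h2)
    have k2 : X ^ (a₁ + r₂) ∣ X ^ a₂ * serD δ₂ (h - cut r₁ h) := by
      rw [ha, pow_add]; exact mul_dvd_mul_left _ (X_pow_dvd_serD _ h1)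
    have k3 : X ^ (a₁ + r₂) ∣ wron (serD D) (h - cut r₁ h) (h - cut r₂ h) :=
      (pow_dvd_pow X (by omega)).trans (X_pow_dvd_wron D h1 h2)
    convert dvd_sub (dvd_sub k2 k1) k3 using 1
    simp only [wron, map_sub] at f₁ f₂ ⊢
    linear_combination f₁ - f₂
  · have d1 := DegLT.cut r₁ h
    have d2 := DegLT.cut r₂ h
    refine (((DegLT.X_pow a₁).mul (d2.serD δ₁) (by omega)).sub
      ((DegLT.X_pow a₂).mul (d1.serD δ₂) (by omega))).sub (d1.wron D d2 (by omega))

end Algebra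

section Algebra

variable {A : Type*} [CommRing A]

/-! ### Reflection of polynomials -/

/-- The reflection `z^m f(1/z)` of a polynomial `f` of degree at most `m`. -/
noncomputable def refl (m : ℕ) (f : A⟦X⟧) : A⟦X⟧ :=
  PowerSeries.mk fun k => if k ≤ m then coeff (m - k) f else 0

@[simp] theorem coeff_refl (k m : ℕ) (f : A⟦X⟧) :
    coeff k (refl m f) = if k ≤ m then coeff (m - k) f else 0 := by simp [refl]

theorem refl_add (m : ℕ) (f g : A⟦X⟧) : refl m (f + g) = refl m f + refl m g := by
  ext k; simp only [coeff_refl, map_add]; split_ifs <;> simp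

theorem refl_sub (m : ℕ) (f g : A⟦X⟧) : refl m (f - g) = refl m f - refl m g := by
  ext k; simp only [coeff_refl, map_sub]; split_ifs <;> simp

theorem refl_two_mul (m : ℕ) (f : A⟦X⟧) : refl m (2 * f) = 2 * refl m f := by
  rw [two_mul, two_mul, refl_add]

theorem refl_X_pow (m : ℕ) : refl m (X ^ m : A⟦X⟧) = 1 := by
  ext k
  rw [coeff_refl, coeff_X_pow, coeff_one]
  split_ifs <;> first | rfl | omega

theorem refl_coe {m : ℕ} {p : Polynomial A} (hp : p.natDegree ≤ m) :
    refl m (p : A⟦X⟧) = (p.reflect m : Polynomial A) := by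
  ext k
  rw [coeff_refl, Polynomial.coeff_coe, Polynomial.coeff_coe, Polynomial.coeff_reflect]
  split_ifs with h
  · rw [Polynomial.revAt_le h]
  · rw [Polynomial.revAt_eq_self_of_lt (not_le.1 h),
      Polynomial.coeff_eq_zero_of_natDegree_lt (lt_of_le_of_lt hp (not_le.1 h))]

theorem DegLT.exists_coe {m : ℕ} {f : A⟦X⟧} (hf : DegLT (m + 1) f) :
    ∃ p : Polynomial A, p.natDegree ≤ m ∧ f = p := by
  refine ⟨trunc (m + 1) f, Nat.le_of_lt_succ (natDegree_trunc_lt f m), ?_⟩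
  ext k
  rw [Polynomial.coeff_coe, coeff_trunc]
  split_ifs with h
  · rfl
  · exact hf k (not_lt.1 h)

theorem refl_mul {m l : ℕ} {f g : A⟦X⟧} (hf : DegLT (m + 1) f) (hg : DegLT (l + 1) g) :
    refl (m + l) (f * g) = refl m f * refl l g := by
  obtain ⟨p, hp, rfl⟩ := hf.exists_coe
  obtain ⟨q, hq, rfl⟩ := hg.exists_coe
  rw [← Polynomial.coe_mul, refl_coe hp, refl_coe hq,
    refl_coe (Polynomial.natDegree_mul_le.trans (add_le_add hp hq)),
    Polynomial.reflect_mul _ _ hp hq, Polynomial.coe_mul]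

variable [Algebra ℝ A]

theorem serD_refl (D : Derivation ℝ A A) (m : ℕ) (f : A⟦X⟧) :
    serD D (refl m f) = refl m (serD D f) := by
  ext k
  rw [coeff_serD, coeff_refl, coeff_refl, coeff_serD]
  split_ifs <;> simp

theorem constantCoeff_quad (D : Derivation ℝ A A) {h : A⟦X⟧} (hh : D (constantCoeff h) = 0) :
    constantCoeff (quad (serD D) h) = 0 := by
  apply smul_half_cancel (B := A)
  have h1 : constantCoeff (serD D h) = 0 := by
    rw [← coeff_zero_eq_constantCoeff_apply, coeff_serD, coeff_zero_eq_constantCoeff_apply, hh]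
  have h2 : constantCoeff (serD D (serD D h)) = 0 := by
    rw [← coeff_zero_eq_constantCoeff_apply, coeff_serD, coeff_zero_eq_constantCoeff_apply, h1,
      map_zero]
  rw [show (2 : A) = constantCoeff (2 : A⟦X⟧) from (map_ofNat _ 2).symm, ← map_mul, two_mul_quad]
  simp [h1, h2]

/-! ### Commuting flows, positive potentials -/

/-- Only N components of the flow are prescribed, but they determine the motion of w, since w has
degree at most N. The motion of w then fixes all remaining coefficients of h. -/
theorem positive_flow (D δ : Derivation ℝ A A) (hc : ∀ x, δ (D x) = D (δ x)) {σ N a : ℕ}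
    (hσ : 1 ≤ σ) (hσN : σ ≤ N) {w h : A⟦X⟧} (hw : DegLT (N + 1) w)
    (h0 : constantCoeff h = 1)
    (heq : 1 + X ^ σ * quad (serD D) h = w * h ^ 2)
    (hδ : ∀ i, 1 ≤ i → i ≤ N →
      δ (coeff i h) = coeff (i + a) (wron (serD D) (cut (a + 1) h) h)) :
    X ^ a * serD δ h = wron (serD D) (cut (a + 1) h) h := by
  have hu : IsUnit h := isUnit_iff_constantCoeff.2 (by rw [h0]; exact isUnit_one)
  have hwh : IsUnit (w * h ^ 2) := by
    rw [← heq, isUnit_iff_constantCoeff]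
    simp [show σ ≠ 0 by omega]
  have hwu : IsUnit (w * h) := by
    rw [pow_two, ← mul_assoc] at hwh
    exact isUnit_of_mul_isUnit_left hwh
  apply flow_of_potentialFlow D δ hc hσ hwu heq
  have lin := linearize (serD D) (serD δ) (serD_comm hc) (c := X ^ σ) (k := 1) (a := X ^ a)
    (cut (a + 1) h)
    (serD_X_pow D σ) (serD_X_pow δ σ) (by simp) (by simp) (serD_X_pow D a) heq
  have hdiv : X ^ (N + a + 1) ∣ X ^ a * serD δ h - wron (serD D) (cut (a + 1) h) h := by
    rw [X_pow_dvd_iff]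
    intro m hm
    have hlow : X ^ (a + 1) ∣ wron (serD D) (cut (a + 1) h) h := by
      -- As the bracket of h with itself is zero, the truncation may be replaced by minus the tail,
      -- so the bracket starts at z^(a+1). At order a the flow side also vanishes, because h(0) = 1
      -- is constant.
      have h1 := X_pow_dvd_sub_cut (a + 1) h
      have h2 := X_pow_dvd_wron_left D h1 h
      rw [← dvd_neg] at h2
      convert h2 using 1
      simp only [wron, map_sub]; ring
    rw [map_sub, coeff_X_pow_mul', coeff_serD]
    split_ifs with hma
    · rcases Nat.eq_or_lt_of_le hma with rfl | hlt
      · rw [X_pow_dvd_iff.1 hlow a (Nat.lt_succ_self a), Nat.sub_self,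
          coeff_zero_eq_constantCoeff_apply, h0]
        simp
      · rw [hδ (m - a) (by omega) (by omega), Nat.sub_add_cancel hma, sub_self]
    · rw [X_pow_dvd_iff.1 hlow m (by omega), sub_zero]
  rw [← sub_eq_zero]
  refine eq_zero_of_dvd_of_degLT (m := N + a + 1) ?_ ?_
  · rw [← (hu.pow 2).dvd_mul_right, ← lin]
    have d1 := X_pow_dvd_serD D hdiv
    have d2 := X_pow_dvd_serD D d1
    exact dvd_sub ((dvd_sub (dvd_sub (d1.mul_left _) (hdiv.mul_right _))
      (d2.mul_left _)).mul_left _) (hdiv.mul_left _)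
  -- The bound σ ≤ N is needed here so that the cocycle term z^σ T''' stays within the degree N + a.
  · exact ((DegLT.X_pow a).mul (hw.serD δ) (by omega)).sub
      ((DegLT.cut (a + 1) h).potentialFlow D hw (by omega) (by omega))

/-- The truncated solution q is replaced by the exact one h, which has the same coefficients up to
z^n. Commutation is proved for all of h and then read off in the first N coefficients. -/
theorem positive_commute (D δ₁ δ₂ : Derivation ℝ A A) (hc₁ : ∀ x, δ₁ (D x) = D (δ₁ x))
    (hc₂ : ∀ x, δ₂ (D x) = D (δ₂ x)) {σ N s n a₁ a₂ : ℕ} (hσ : 1 ≤ σ) (hσN : σ ≤ N)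
    (hn : n + 1 = s + N) (ha₁ : a₁ < s) (ha₂ : a₂ < s) {w q : A⟦X⟧} (hw : DegLT (N + 1) w)
    (h0 : constantCoeff q = 1)
    (heq : X ^ (n + 1) ∣ 1 + X ^ σ * quad (serD D) q - w * q ^ 2)
    (hδ₁ : ∀ i, 1 ≤ i → i ≤ N →
      δ₁ (coeff i q) = coeff (i + a₁) (wron (serD D) (cut (a₁ + 1) q) q))
    (hδ₂ : ∀ i, 1 ≤ i → i ≤ N →
      δ₂ (coeff i q) = coeff (i + a₂) (wron (serD D) (cut (a₂ + 1) q) q))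
    (i : ℕ) (hi : i ≤ N) : δ₁ (δ₂ (coeff i q)) = δ₂ (δ₁ (coeff i q)) := by
  have hw0 : constantCoeff w = 1 := by
    have := X_pow_dvd_iff.1 heq 0 (by omega)
    rw [coeff_zero_eq_constantCoeff_apply] at this
    simp [show σ ≠ 0 by omega, h0] at this
    linear_combination -this
  obtain ⟨h, hh0, hh⟩ := exists_solution D hσ w 1 (by rw [hw0]; ring)
  have hcong : X ^ (n + 1) ∣ q - h := by
    refine solution_congr D hσ (w := w) ?_ ?_ heq ?_
    · rw [isUnit_iff_constantCoeff, map_mul, hw0, h0]; simp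
    · rw [X_dvd_iff, map_sub, h0, hh0, sub_self]
    · rw [hh, sub_self]; exact dvd_zero _
  have hcoef : ∀ k, k ≤ n → coeff k q = coeff k h := by
    intro k hk
    have := X_pow_dvd_iff.1 hcong k (by omega)
    rwa [map_sub, sub_eq_zero] at this
  have transfer : ∀ (δ : Derivation ℝ A A) (a : ℕ), a < s →
      (∀ i, 1 ≤ i → i ≤ N →
        δ (coeff i q) = coeff (i + a) (wron (serD D) (cut (a + 1) q) q)) →
      ∀ i, 1 ≤ i → i ≤ N →
        δ (coeff i h) = coeff (i + a) (wron (serD D) (cut (a + 1) h) h) := by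
    intro δ a ha hδ i h1 h2
    have hcut : cut (a + 1) q = cut (a + 1) h := by
      ext k
      rw [coeff_cut, coeff_cut]
      split_ifs
      · exact hcoef k (by omega)
      · rfl
    rw [← hcoef i (by omega), hδ i h1 h2, hcut, ← sub_eq_zero, ← map_sub]
    have hd := X_pow_dvd_wron_right D hcong (cut (a + 1) h)
    -- Here i + a ≤ N + s - 1 = n: exactly s flows see only coefficients on which q and h agree.
    have := X_pow_dvd_iff.1 hd (i + a) (by omega)
    rw [← this]
    congr 1
    simp only [wron, map_sub]; ring
  have f₁ := positive_flow D δ₁ hc₁ hσ hσN hw hh0 hh (transfer δ₁ a₁ ha₁ hδ₁)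
  have f₂ := positive_flow D δ₂ hc₂ hσ hσN hw hh0 hh (transfer δ₂ a₂ ha₂ hδ₂)
  have hz := zero_curvature D δ₁ δ₂ (by omega) (by omega) (by omega) f₁ f₂
  have := wron_jacobi_commutator (serD D) (serD δ₁) (serD δ₂) (serD_comm hc₁) (serD_comm hc₂)
    (serD_X_pow D a₁) (serD_X_pow D a₂) (serD_X_pow δ₁ a₂) (serD_X_pow δ₂ a₁) hz
    (e₁ := 0) (e₂ := 0) (by rw [f₁, add_zero]) (by rw [f₂, add_zero])
  have h2 := congrArg (coeff (a₁ + a₂ + i)) this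
  simp only [wron, map_zero, mul_zero, sub_self, add_zero, ← pow_add] at h2
  rw [add_comm (a₁ + a₂) i, coeff_X_pow_mul] at h2
  simp only [map_sub, coeff_serD] at h2
  rw [hcoef i (by omega)]
  exact sub_eq_zero.1 h2

/-! ### Commuting flows, negative potentials -/

/-- The polynomial w is seen from both ends. Near z = 0 it is, reflected, the start of S(q)/q², so
the approximate flow of q gives the upper coefficients of its equation of motion; the lower ones
follow from h solving its own equation. -/
theorem negative_flow (D δ : Derivation ℝ A A) (hc : ∀ x, δ (D x) = D (δ x)) {σ N r : ℕ}
    (hσ : 1 ≤ σ) (hσN : σ ≤ N) {w h q W : A⟦X⟧} (hw : DegLT σ w)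
    (h0 : IsUnit h) (heq : 1 + X ^ σ * quad (serD D) h = w * h ^ 2)
    (q0 : constantCoeff q = 1) (hW : quad (serD D) q = W * q ^ 2)
    (hWw : ∀ k, k < σ → coeff (σ - k) W = coeff k w)
    (hδ : X ^ (N + 1) ∣ serD δ q - wron (serD D) (refl r (cut r h)) q) :
    X ^ r * serD δ h = wron (serD D) (cut r h) h := by
  have hu : IsUnit q := isUnit_iff_constantCoeff.2 (by rw [q0]; exact isUnit_one)
  have hwh : IsUnit (w * h ^ 2) := by
    rw [← heq, isUnit_iff_constantCoeff]
    simp [show σ ≠ 0 by omega]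
  have hwu : IsUnit (w * h) := by
    rw [pow_two, ← mul_assoc] at hwh
    exact isUnit_of_mul_isUnit_left hwh
  apply flow_of_potentialFlow D δ hc hσ hwu heq
  set T := cut r h with hT
  have dT : DegLT (r + 1) T := (DegLT.cut r h).mono (Nat.le_succ r)
  have dw : DegLT (σ + 1) w := hw.mono (Nat.le_succ σ)
  have hW0 : constantCoeff W = 0 := by
    have h1 := constantCoeff_quad D (h := q) (by rw [q0]; simp)
    rw [hW, map_mul, map_pow, q0] at h1
    simpa using h1
  have hWz : X ^ (σ + 1) ∣ W - refl σ w := by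
    rw [X_pow_dvd_iff]
    intro k hk
    rw [map_sub, coeff_refl, if_pos (by omega)]
    rcases Nat.eq_zero_or_pos k with rfl | hk0
    · rw [coeff_zero_eq_constantCoeff_apply, hW0, hw (σ - 0) (by omega), sub_zero]
    · have := hWw (σ - k) (by omega)
      rw [Nat.sub_sub_self (by omega)] at this
      rw [this, sub_self]
  -- The expansion at z = 0 uses the same linearization without free term and without a power of z
  -- before S.
  have lin := linearize (serD D) (serD δ) (serD_comm hc) (c := 1) (k := 0) (a := 1)
    (refl r T) (by simp) (by simp) (by simp) (by simp) (by simp)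
    (show 0 + 1 * quad (serD D) q = W * q ^ 2 by rw [zero_add, one_mul, hW])
  simp only [one_mul] at lin
  have hflow : X ^ (σ + 1) ∣ serD δ (refl σ w) - potentialFlow (serD D) 1 (refl r T) (refl σ w) := by
    have h1 : X ^ (σ + 1) ∣ serD δ W - potentialFlow (serD D) 1 (refl r T) W := by
      rw [← (hu.pow 2).dvd_mul_right, ← lin]
      have hδ' := (pow_dvd_pow (X : A⟦X⟧) (show σ + 1 ≤ N + 1 by omega)).trans hδ
      have d1 := X_pow_dvd_serD D hδ'
      have d2 := X_pow_dvd_serD D d1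
      exact dvd_sub (dvd_sub (dvd_sub (d1.mul_left _) (hδ'.mul_right _))
        (d2.mul_left _)) (hδ'.mul_left _)
    have h2 := X_pow_dvd_serD δ hWz
    have h3 := X_pow_dvd_serD D hWz
    have h4 : X ^ (σ + 1) ∣ potentialFlow (serD D) 1 (refl r T) W
        - potentialFlow (serD D) 1 (refl r T) (refl σ w) := by
      convert dvd_add (h3.mul_left (refl r T)) (hWz.mul_left (2 * serD D (refl r T))) using 1
      simp only [potentialFlow, map_sub]; ring
    convert dvd_add (dvd_sub h1 h2) h4 using 1
    simp only [map_sub]; ring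
  have hrefl : refl (r + σ) (potentialFlow (serD D) (X ^ σ) T w) =
      potentialFlow (serD D) 1 (refl r T) (refl σ w) := by
    rw [potentialFlow, potentialFlow, refl_add, refl_add, refl_mul dT (dw.serD D),
      refl_mul ((dT.serD D).two_mul) dw, mul_comm (X ^ σ),
      refl_mul (((dT.serD D).serD D).serD D) (DegLT.X_pow σ), refl_X_pow, refl_two_mul]
    simp only [serD_refl]
    ring
  have hlow := X_pow_dvd_potentialFlow_cut D h0 heq r
  have hdeg := (DegLT.cut r h).potentialFlow D (σ := σ) (p := r + σ) hw (by omega) (by omega)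
  rw [← hT] at hlow hdeg
  -- Three ranges of degree. Below r both sides have no terms, since T is a truncation of h; from r
  -- to r + σ - 1 the reflected flow at z = 0 applies; from r + σ on, both sides vanish by degree.
  ext k
  rw [coeff_X_pow_mul', coeff_serD]
  split_ifs with hk
  · rcases lt_or_ge k (r + σ) with hk2 | hk2
    · have := X_pow_dvd_iff.1 hflow (r + σ - k) (by omega)
      rw [← hrefl, map_sub, sub_eq_zero, coeff_serD, coeff_refl, coeff_refl, if_pos (by omega),
        if_pos (by omega)] at this
      rwa [show σ - (r + σ - k) = k - r by omega,
        show r + σ - (r + σ - k) = k by omega] at this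
    · rw [hdeg k hk2, hw (k - r) (by omega), map_zero]
  · rw [X_pow_dvd_iff.1 hlow k (by omega)]

/-- Replacing the truncation of q by its complement changes the sign of the flow, so -δ₁ and -δ₂ are
the flows generated by truncations of h. The complement has n + 1 - r ≤ n - N coefficients because r
> N, and this is the range in which the reflection of q agrees with h. -/
theorem negative_commute (D δ₁ δ₂ : Derivation ℝ A A) (hc₁ : ∀ x, δ₁ (D x) = D (δ₁ x))
    (hc₂ : ∀ x, δ₂ (D x) = D (δ₂ x)) {σ N s n r₁ r₂ : ℕ} (hσ : 1 ≤ σ) (hσN : σ ≤ N)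
    (hn : n + 1 = s + 2 * N) (hr₁ : N < r₁) (hr₁' : r₁ ≤ N + s) (hr₂ : N < r₂) (hr₂' : r₂ ≤ N + s)
    {w q W Q : A⟦X⟧} (hw : DegLT σ w) (hs : 1 ≤ s)
    (q0 : constantCoeff q = 1) (hq : DegLT (n + 1) q) (hQ : ∀ k, k ≤ n → coeff k Q = coeff (n - k) q)
    (hQu : IsUnit Q)
    (heq : X ^ (n - N) ∣ 1 + X ^ σ * quad (serD D) Q - w * Q ^ 2)
    (hW : quad (serD D) q = W * q ^ 2)
    (hWw : ∀ k, k < σ → coeff (σ - k) W = coeff k w)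
    (hδ₁ : ∀ i, 1 ≤ i → i ≤ N →
      δ₁ (coeff i q) = coeff (i + (r₁ - 1)) (wron (serD D) (cut r₁ q) q))
    (hδ₂ : ∀ i, 1 ≤ i → i ≤ N →
      δ₂ (coeff i q) = coeff (i + (r₂ - 1)) (wron (serD D) (cut r₂ q) q))
    (i : ℕ) (hi : i ≤ N) : δ₁ (δ₂ (coeff i q)) = δ₂ (δ₁ (coeff i q)) := by
  have hQ0 : constantCoeff Q ^ 2 * constantCoeff w = 1 := by
    have := X_pow_dvd_iff.1 heq 0 (by omega)
    rw [coeff_zero_eq_constantCoeff_apply] at this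
    simp [show σ ≠ 0 by omega] at this
    linear_combination -this
  obtain ⟨h, hh0, hh⟩ := exists_solution D hσ w _ hQ0
  have hhu : IsUnit h := by
    rw [isUnit_iff_constantCoeff] at hQu ⊢; rwa [hh0]
  have hcong : X ^ (n - N) ∣ Q - h := by
    refine solution_congr D hσ (w := w) ?_ ?_ heq ?_
    · refine IsUnit.mul ?_ hQu
      rw [isUnit_iff_constantCoeff]
      exact IsUnit.of_mul_eq_one (constantCoeff Q ^ 2) (by rw [mul_comm, hQ0])
    · rw [X_dvd_iff, map_sub, hh0, sub_self]
    · rw [hh, sub_self]; exact dvd_zero _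
  have hcoef : ∀ k, k < n - N → coeff k h = coeff (n - k) q := by
    intro k hk
    have := X_pow_dvd_iff.1 hcong k hk
    rw [map_sub, sub_eq_zero] at this
    rw [← this, hQ k (by omega)]
  have hcN : ∀ δ : Derivation ℝ A A, (∀ x, δ (D x) = D (δ x)) → ∀ x, (-δ) (D x) = D ((-δ) x) := by
    intro δ h x; simp [h]
  have transfer : ∀ (δ : Derivation ℝ A A) (r : ℕ), N < r → r ≤ N + s →
      (∀ i, 1 ≤ i → i ≤ N →
        δ (coeff i q) = coeff (i + (r - 1)) (wron (serD D) (cut r q) q)) →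
      X ^ (N + 1) ∣ serD (-δ) q -
        wron (serD D) (refl (n + 1 - r) (cut (n + 1 - r) h)) q := by
    intro δ r hr hr' hδ
    -- The shift r - 1 and the length n + 1 - r fit so that the reflected polynomial has zero
    -- constant term: its terms start at z^r in q, and its last one is z^n.
    have hM : q = cut r q + X ^ (r - 1) * refl (n + 1 - r) (cut (n + 1 - r) h) := by
      ext k
      rw [map_add, coeff_cut, coeff_X_pow_mul', coeff_refl, coeff_cut]
      by_cases h1 : k < r
      · rw [if_pos h1]
        split_ifs <;> first | omega | simp
      · rw [if_neg h1, if_pos (show r - 1 ≤ k by omega), zero_add]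
        split_ifs with h2 h3
        · rw [hcoef (n + 1 - r - (k - (r - 1))) (by omega)]; congr 2; omega
        · omega
        · exact hq k (by omega)
    set M := refl (n + 1 - r) (cut (n + 1 - r) h) with hMdef
    have hwr : wron (serD D) (cut r q) q = - (X ^ (r - 1) * wron (serD D) M q) := by
      have h1 : cut r q = q - X ^ (r - 1) * M := by rw [eq_sub_iff_add_eq]; exact hM.symm
      rw [h1]
      simp only [wron, map_sub, Derivation.leibniz, serD_X_pow, smul_eq_mul]
      ring
    rw [X_pow_dvd_iff]
    intro k hk
    rw [map_sub, coeff_serD, Derivation.neg_apply]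
    rcases Nat.eq_zero_or_pos k with rfl | hk0
    · have hM0 : X ∣ M := by
        rw [X_dvd_iff, ← coeff_zero_eq_constantCoeff_apply, hMdef, coeff_refl, coeff_cut]
        simp
      have : X ^ 1 ∣ wron (serD D) M q := X_pow_dvd_wron_left D (by rwa [pow_one]) q
      rw [X_pow_dvd_iff.1 this 0 one_pos, coeff_zero_eq_constantCoeff_apply, q0]
      simp
    · rw [hδ k hk0 (by omega), hwr, map_neg, coeff_X_pow_mul, neg_neg, sub_self]
  have t₁ := transfer δ₁ r₁ hr₁ hr₁' hδ₁
  have t₂ := transfer δ₂ r₂ hr₂ hr₂' hδ₂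
  have f₁ := negative_flow D (-δ₁) (hcN _ hc₁) hσ hσN hw hhu hh q0 hW hWw t₁
  have f₂ := negative_flow D (-δ₂) (hcN _ hc₂) hσ hσN hw hhu hh q0 hW hWw t₂
  have hz := zero_curvature D (-δ₁) (-δ₂) (by omega) le_rfl (Nat.le_succ _) f₁ f₂
  set p₁ := n + 1 - r₁
  set p₂ := n + 1 - r₂
  have c₁ : DegLT (p₁ + 1) (cut p₁ h) := (DegLT.cut p₁ h).mono (Nat.le_succ _)
  have c₂ : DegLT (p₂ + 1) (cut p₂ h) := (DegLT.cut p₂ h).mono (Nat.le_succ _)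
  -- Reflection in degree p₁ + p₂ turns the factors z^(p₁), z^(p₂) into 1, so the zero curvature
  -- equation of h becomes one fit for the flows of q.
  have hz' : (1 : A⟦X⟧) * serD (-δ₁) (refl p₂ (cut p₂ h)) - 1 * serD (-δ₂) (refl p₁ (cut p₁ h)) =
      wron (serD D) (refl p₁ (cut p₁ h)) (refl p₂ (cut p₂ h)) := by
    have := congrArg (refl (p₁ + p₂)) hz
    rw [wron, refl_sub, refl_sub, refl_mul (DegLT.X_pow _) (c₂.serD _),
      add_comm p₁ p₂, refl_mul (DegLT.X_pow _) (c₁.serD _), add_comm p₂ p₁,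
      refl_mul c₁ (c₂.serD _), refl_mul (c₁.serD _) c₂] at this
    simpa only [refl_X_pow, serD_refl, wron] using this
  have key := wron_jacobi_commutator (serD D) (serD (-δ₁)) (serD (-δ₂)) (serD_comm (hcN _ hc₁))
    (serD_comm (hcN _ hc₂)) (h := q)
    (by simp) (by simp) (by simp) (by simp) hz'
    (e₁ := serD (-δ₁) q - wron (serD D) (refl p₁ (cut p₁ h)) q)
    (e₂ := serD (-δ₂) q - wron (serD D) (refl p₂ (cut p₂ h)) q) (by ring) (by ring)
  -- Both defects are divisible by z^(N+1), and neither brackets nor flows lower that order; this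
  -- covers every retained coefficient.
  have hdvd : X ^ (N + 1) ∣ serD (-δ₁) (serD (-δ₂) q) - serD (-δ₂) (serD (-δ₁) q) := by
    rw [mul_one, one_mul] at key
    rw [key, one_mul, one_mul]
    have w1 := X_pow_dvd_wron_right D t₁ (refl p₂ (cut p₂ h))
    have w2 := X_pow_dvd_wron_right D t₂ (refl p₁ (cut p₁ h))
    exact dvd_sub (dvd_add (dvd_sub w1 w2) (X_pow_dvd_serD _ t₂)) (X_pow_dvd_serD _ t₁)
  have := X_pow_dvd_iff.1 hdvd i (by omega)
  simp only [map_sub, coeff_serD, Derivation.neg_apply, map_neg, neg_neg] at this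
  exact sub_eq_zero.1 this

end Algebra

/-! ### The algebra of differential functions on an open set -/

section DiffFun

variable {N : ℕ}

theorem isOpen_truncJet_image (K : ℕ) {U : Set (Jet N)} (hU : IsOpen U) :
    IsOpen (truncJet K '' U) := by
  rw [isOpen_iff_mem_nhds]
  rintro _ ⟨u, hu, rfl⟩
  -- A continuous section of the truncation through u: the missing higher coordinates are taken from
  -- u. Its preimage of U is a neighbourhood inside the image.
  set s : (Fin N → Fin K → ℝ) → Jet N := fun y i k => if h : k < K then y i ⟨k, h⟩ else u i k
    with hs
  have hsc : Continuous s := by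
    refine continuous_pi fun i => continuous_pi fun k => ?_
    simp only [hs]
    split_ifs
    · fun_prop
    · fun_prop
  have hsu : s (truncJet K u) = u := by
    funext i k
    simp only [hs, truncJet]
    split_ifs <;> rfl
  have hts : ∀ y, truncJet K (s y) = y := by
    intro y; funext i k
    simp [hs, truncJet]
  have : s ⁻¹' U ∈ nhds (truncJet K u) :=
    hsc.continuousAt.preimage_mem_nhds (hU.mem_nhds (by rw [hsu]; exact hu))
  exact Filter.mem_of_superset this fun y hy => ⟨s y, hy, hts y⟩

/-- `g` depends smoothly on the jet coordinates of order less than `K`. -/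
def HasOrder (U : Opens (Jet N)) (K : ℕ) (g : U → ℝ) : Prop :=
  ∃ F : (Fin N → Fin K → ℝ) → ℝ, ContDiffOn ℝ ∞ F (truncJet K '' (U : Set (Jet N))) ∧
    ∀ u : U, g u = F (truncJet K u)

variable {U : Opens (Jet N)}

theorem HasOrder.mono {K L : ℕ} (h : K ≤ L) {g : U → ℝ} (hg : HasOrder U K g) :
    HasOrder U L g := by
  obtain ⟨F, hF, hgF⟩ := hg
  refine ⟨fun y => F fun i k => y i ⟨k, k.2.trans_le h⟩, ?_, fun u => hgF u⟩
  refine hF.comp (t := truncJet K '' (U : Set (Jet N))) ?_ ?_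
  · refine ContDiff.contDiffOn ?_
    fun_prop
  · rintro _ ⟨u, hu, rfl⟩
    exact ⟨u, hu, rfl⟩

theorem HasOrder.comp₂ {K : ℕ} {f g : U → ℝ} (hf : HasOrder U K f) (hg : HasOrder U K g)
    {op : ℝ → ℝ → ℝ} (hop : ContDiff ℝ ∞ fun p : ℝ × ℝ => op p.1 p.2) :
    HasOrder U K fun u => op (f u) (g u) := by
  obtain ⟨F, hF, hfF⟩ := hf
  obtain ⟨G, hG, hgG⟩ := hg
  exact ⟨fun y => op (F y) (G y), hop.comp_contDiffOn (hF.prodMk hG),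
    fun u => congrArg₂ op (hfF u) (hgG u)⟩

/-- The algebra of differential functions on `U`. -/
def DiffFun (U : Opens (Jet N)) : Subalgebra ℝ (U → ℝ) where
  carrier := {g | ∃ K, HasOrder U K g}
  mul_mem' := by
    rintro f g ⟨K, hf⟩ ⟨L, hg⟩
    exact ⟨max K L, (hf.mono (le_max_left _ _)).comp₂ (hg.mono (le_max_right _ _))
      (op := fun a b => a * b) (by fun_prop)⟩
  add_mem' := by
    rintro f g ⟨K, hf⟩ ⟨L, hg⟩
    exact ⟨max K L, (hf.mono (le_max_left _ _)).comp₂ (hg.mono (le_max_right _ _))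
      (op := fun a b => a + b) (by fun_prop)⟩
  algebraMap_mem' := fun c => ⟨0, fun _ => c, contDiffOn_const, fun _ => rfl⟩

/-- The jet coordinate `q_{i+1}^{(k)}` as a differential function. -/
def coordFun (U : Opens (Jet N)) (i : Fin N) (k : ℕ) : DiffFun U :=
  ⟨fun u => (u : Jet N) i k, k + 1, fun y => y i ⟨k, Nat.lt_succ_self k⟩,
    ContDiff.contDiffOn (by fun_prop), fun _ => rfl⟩

open Classical in
/-- The extension of a differential function by zero. -/
noncomputable def extFun (g : U → ℝ) : Jet N → ℝ := fun u => if h : u ∈ U then g ⟨u, h⟩ else 0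

theorem extFun_apply (g : U → ℝ) (u : U) : extFun g (u : Jet N) = g u := by
  simp [extFun]

theorem eventually_line_mem (u : U) (w : Jet N) :
    ∀ᶠ t : ℝ in nhds 0, (u : Jet N) + t • w ∈ U := by
  have hc : Continuous fun t : ℝ => (u : Jet N) + t • w := by fun_prop
  apply hc.continuousAt.preimage_mem_nhds
  apply U.isOpen.mem_nhds
  simp

theorem hasLineDerivAt_extFun {K : ℕ} {F : (Fin N → Fin K → ℝ) → ℝ} {g : U → ℝ}
    (hF : ContDiffOn ℝ ∞ F (truncJet K '' (U : Set (Jet N))))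
    (hg : ∀ u : U, g u = F (truncJet K u)) (u : U) (w : Jet N) :
    HasLineDerivAt ℝ (extFun g) (fderiv ℝ F (truncJet K u) (truncJet K w)) (u : Jet N) w := by
  have hmem : truncJet K '' (U : Set (Jet N)) ∈ nhds (truncJet K (u : Jet N)) :=
    (isOpen_truncJet_image K U.isOpen).mem_nhds ⟨u, u.2, rfl⟩
  have hd : HasFDerivAt F (fderiv ℝ F (truncJet K u)) (truncJet K u) :=
    ((hF.contDiffAt hmem).differentiableAt (by simp)).hasFDerivAt
  refine HasDerivAt.congr_of_eventuallyEq (hd.hasLineDerivAt (truncJet K w)) ?_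
  filter_upwards [eventually_line_mem u w] with t ht
  rw [extFun, dif_pos ht, hg]
  rfl

theorem HasOrder.differentiable {K : ℕ} {g : U → ℝ} (hg : HasOrder U K g) (u : U) (w : Jet N) :
    LineDifferentiableAt ℝ (extFun g) (u : Jet N) w := by
  obtain ⟨F, hF, h⟩ := hg
  exact (hasLineDerivAt_extFun hF h u w).lineDifferentiableAt

/-- The partial derivative, as a function on `U`. -/
noncomputable def pdFun (i : Fin N) (k : ℕ) (g : U → ℝ) : U → ℝ :=
  fun u => lineDeriv ℝ (extFun g) (u : Jet N) (Pi.single i (Pi.single k 1))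

theorem truncJet_single (K : ℕ) (i : Fin N) (k : Fin K) :
    truncJet K (Pi.single i (Pi.single (k : ℕ) 1) : Jet N) = Pi.single i (Pi.single k 1) := by
  funext j l
  simp only [truncJet]
  by_cases hj : j = i
  · subst hj
    simp only [Pi.single_eq_same, Pi.single_apply, Fin.ext_iff]
  · simp [hj]

theorem HasOrder.pdFun {K : ℕ} {g : U → ℝ} (hg : HasOrder U K g) (i : Fin N) (k : ℕ) :
    HasOrder U K (pdFun i k g) := by
  obtain ⟨F, hF, h⟩ := hg
  refine ⟨fun y => fderiv ℝ F y (truncJet K (Pi.single i (Pi.single k 1))), ?_,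
    fun u => (hasLineDerivAt_extFun hF h u _).lineDeriv⟩
  exact (hF.fderiv_of_isOpen (m := ∞) (isOpen_truncJet_image K U.isOpen) (by simp)).clm_apply
    contDiffOn_const

theorem HasOrder.lineDeriv_eq_sum {K : ℕ} {g : U → ℝ} (hg : HasOrder U K g) (u : U) (w : Jet N) :
    lineDeriv ℝ (extFun g) (u : Jet N) w =
      ∑ p ∈ Finset.univ ×ˢ Finset.range K, KillingReduction.pdFun p.1 p.2 g u * w p.1 p.2 := by
  rw [Finset.sum_product]
  obtain ⟨F, hF, h⟩ := hg
  rw [(hasLineDerivAt_extFun hF h u w).lineDeriv]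
  have hw : truncJet K w = ∑ i, ∑ k : Fin K, w i k • (Pi.single i (Pi.single k 1) :
      Fin N → Fin K → ℝ) := by
    funext j l
    simp only [Finset.sum_apply, Pi.smul_apply, smul_eq_mul, truncJet]
    rw [Finset.sum_eq_single j (by intro b _ hb; simp [Ne.symm hb]) (by simp),
      Finset.sum_eq_single l (by intro b _ hb; simp [Ne.symm hb]) (by simp)]
    simp
  rw [hw, map_sum]
  refine Finset.sum_congr rfl fun i _ => ?_
  rw [map_sum, ← Fin.sum_univ_eq_sum_range (fun k => KillingReduction.pdFun i k g u * w i k)]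
  refine Finset.sum_congr rfl fun k _ => ?_
  rw [map_smul, smul_eq_mul, mul_comm, KillingReduction.pdFun,
    (hasLineDerivAt_extFun hF h u _).lineDeriv, truncJet_single]

theorem HasOrder.pdFun_comm {K : ℕ} {g : U → ℝ} (hg : HasOrder U K g) (i j : Fin N) (k l : ℕ) :
    KillingReduction.pdFun i k (KillingReduction.pdFun j l g) =
      KillingReduction.pdFun j l (KillingReduction.pdFun i k g) := by
  obtain ⟨F, hF, h⟩ := hg
  have hopen := isOpen_truncJet_image K U.isOpen
  funext u
  have hmem : truncJet K '' (U : Set (Jet N)) ∈ nhds (truncJet K (u : Jet N)) :=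
    hopen.mem_nhds ⟨u, u.2, rfl⟩
  have hF' : ∀ w : Fin N → Fin K → ℝ, ContDiffOn ℝ ∞ (fun y => fderiv ℝ F y w)
      (truncJet K '' (U : Set (Jet N))) := fun w =>
    (hF.fderiv_of_isOpen (m := ∞) hopen (by simp)).clm_apply contDiffOn_const
  have key : ∀ (a b : Fin N) (c d : ℕ),
      KillingReduction.pdFun a c (KillingReduction.pdFun b d g) u =
      fderiv ℝ (fderiv ℝ F) (truncJet K (u : Jet N))
        (truncJet K (Pi.single a (Pi.single c 1))) (truncJet K (Pi.single b (Pi.single d 1))) := by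
    intro a b c d
    rw [KillingReduction.pdFun, (hasLineDerivAt_extFun (g := KillingReduction.pdFun b d g)
      (hF' (truncJet K (Pi.single b (Pi.single d 1))))
      (fun v => (hasLineDerivAt_extFun hF h v _).lineDeriv) u _).lineDeriv]
    have hd : DifferentiableAt ℝ (fderiv ℝ F) (truncJet K (u : Jet N)) :=
      ((hF.fderiv_of_isOpen (m := ∞) hopen (by simp)).contDiffAt hmem).differentiableAt (by simp)
    rw [fderiv_clm_apply hd (differentiableAt_const _)]
    simp
  rw [key, key]
  exact ((hF.contDiffAt hmem).isSymmSndFDerivAt (by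
    simp only [minSmoothness_of_isRCLikeNormedField]; exact WithTop.coe_le_coe.2 le_top)).eq _ _

/-- The derivative of a differential function along a field of directions. -/
noncomputable def dirFun (v : Fin N → ℕ → DiffFun U) (g : DiffFun U) : DiffFun U :=
  ⟨fun u => lineDeriv ℝ (extFun g.1) (u : Jet N) (fun i k => (v i k).1 u), by
    obtain ⟨K, hK⟩ := g.2
    have : (fun u : U => lineDeriv ℝ (extFun g.1) (u : Jet N) (fun i k => (v i k).1 u)) =
        ∑ p ∈ Finset.univ ×ˢ Finset.range K, pdFun p.1 p.2 g.1 * (v p.1 p.2).1 := by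
      funext u
      rw [hK.lineDeriv_eq_sum]
      simp
    rw [this]
    exact Subalgebra.sum_mem _ fun p _ =>
      Subalgebra.mul_mem _ ⟨K, hK.pdFun p.1 p.2⟩ (v p.1 p.2).2⟩

theorem DiffFun.hasLineDerivAt (g : DiffFun U) (u : U) (w : Jet N) :
    HasDerivAt (fun t : ℝ => extFun g.1 ((u : Jet N) + t • w))
      (lineDeriv ℝ (extFun g.1) (u : Jet N) w) 0 := by
  obtain ⟨K, hK⟩ := g.2
  exact (hK.differentiable u w).hasLineDerivAt

theorem DiffFun.lineDeriv_add (f g : DiffFun U) (u : U) (w : Jet N) :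
    lineDeriv ℝ (extFun (f + g).1) (u : Jet N) w =
      lineDeriv ℝ (extFun f.1) (u : Jet N) w + lineDeriv ℝ (extFun g.1) (u : Jet N) w := by
  refine HasDerivAt.deriv (((DiffFun.hasLineDerivAt f u w).add
    (DiffFun.hasLineDerivAt g u w)).congr_of_eventuallyEq ?_)
  filter_upwards [eventually_line_mem u w] with t ht
  simp only [Pi.add_apply, extFun, dif_pos ht]
  rfl

theorem DiffFun.lineDeriv_smul (c : ℝ) (g : DiffFun U) (u : U) (w : Jet N) :
    lineDeriv ℝ (extFun (c • g).1) (u : Jet N) w =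
      c * lineDeriv ℝ (extFun g.1) (u : Jet N) w := by
  refine HasDerivAt.deriv (((DiffFun.hasLineDerivAt g u w).const_mul c).congr_of_eventuallyEq ?_)
  filter_upwards [eventually_line_mem u w] with t ht
  simp only [extFun, dif_pos ht]
  rfl

theorem DiffFun.lineDeriv_mul (f g : DiffFun U) (u : U) (w : Jet N) :
    lineDeriv ℝ (extFun (f * g).1) (u : Jet N) w =
      lineDeriv ℝ (extFun f.1) (u : Jet N) w * g.1 u
        + f.1 u * lineDeriv ℝ (extFun g.1) (u : Jet N) w := by
  have h := (DiffFun.hasLineDerivAt f u w).mul (DiffFun.hasLineDerivAt g u w)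
  simp only [zero_smul, add_zero, extFun_apply] at h
  refine HasDerivAt.deriv (h.congr_of_eventuallyEq ?_)
  filter_upwards [eventually_line_mem u w] with t ht
  simp only [Pi.mul_apply, extFun, dif_pos ht]
  rfl

/-- The derivation of differential functions along a field of directions. -/
noncomputable def dirDeriv (v : Fin N → ℕ → DiffFun U) :
    Derivation ℝ (DiffFun U) (DiffFun U) :=
  Derivation.mk'
    { toFun := dirFun v
      map_add' := fun f g => Subtype.ext (funext fun u => DiffFun.lineDeriv_add f g u _)
      map_smul' := fun c g => Subtype.ext (funext fun u => DiffFun.lineDeriv_smul c g u _) }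
    (fun f g => Subtype.ext (funext fun u => (DiffFun.lineDeriv_mul f g u _).trans (by
      simp only [LinearMap.coe_mk, AddHom.coe_mk, smul_eq_mul]
      change _ = f.1 u * lineDeriv ℝ (extFun g.1) (u : Jet N) _
        + g.1 u * lineDeriv ℝ (extFun f.1) (u : Jet N) _
      ring)))

theorem dirDeriv_apply (v : Fin N → ℕ → DiffFun U) (g : DiffFun U) (u : U) :
    (dirDeriv v g).1 u = lineDeriv ℝ (extFun g.1) (u : Jet N) (fun i k => (v i k).1 u) := by
  rfl

/-- The partial derivative of a differential function. -/
noncomputable def pd (i : Fin N) (k : ℕ) (g : DiffFun U) : DiffFun U :=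
  ⟨pdFun i k g.1, g.2.imp fun _ hK => hK.pdFun i k⟩

theorem dirDeriv_eq_sum (v : Fin N → ℕ → DiffFun U) {g : DiffFun U} {K : ℕ}
    (hg : HasOrder U K g.1) :
    dirDeriv v g = ∑ p ∈ Finset.univ ×ˢ Finset.range K, pd p.1 p.2 g * v p.1 p.2 := by
  refine Subtype.ext (funext fun u => ?_)
  rw [dirDeriv_apply, hg.lineDeriv_eq_sum]
  simp [pd]

/-- By finite order and the chain rule, the second derivatives contribute a symmetric expression;
what remains is the action on the components of the directions, which `h` equates. -/
theorem dirDeriv_comm (v w : Fin N → ℕ → DiffFun U)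
    (h : ∀ i k, dirDeriv v (w i k) = dirDeriv w (v i k)) (g : DiffFun U) :
    dirDeriv v (dirDeriv w g) = dirDeriv w (dirDeriv v g) := by
  obtain ⟨K, hK⟩ := g.2
  have key : ∀ v w : Fin N → ℕ → DiffFun U, dirDeriv v (dirDeriv w g) =
      (∑ p ∈ Finset.univ ×ˢ Finset.range K, ∑ q ∈ Finset.univ ×ˢ Finset.range K,
        pd q.1 q.2 (pd p.1 p.2 g) * v q.1 q.2 * w p.1 p.2)
      + ∑ p ∈ Finset.univ ×ˢ Finset.range K, pd p.1 p.2 g * dirDeriv v (w p.1 p.2) := by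
    intro v w
    rw [dirDeriv_eq_sum w hK, map_sum, ← Finset.sum_add_distrib]
    refine Finset.sum_congr rfl fun p _ => ?_
    rw [Derivation.leibniz, dirDeriv_eq_sum v (g := pd p.1 p.2 g) (hK.pdFun p.1 p.2), smul_eq_mul,
      smul_eq_mul, add_comm, mul_comm (w p.1 p.2), Finset.sum_mul]
  have hsymm : ∀ (i j : Fin N) (k l : ℕ), pd i k (pd j l g) = pd j l (pd i k g) :=
    fun i j k l => Subtype.ext (hK.pdFun_comm i j k l)
  rw [key v w, key w v, Finset.sum_comm]
  congr 1
  · refine Finset.sum_congr rfl fun p _ => Finset.sum_congr rfl fun q _ => ?_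
    rw [hsymm, mul_right_comm]
  · simp only [h]

end DiffFun

/-! ### Total derivative, evolutionary fields and their commutator. -/

section Evolution

variable {N : ℕ} {U : Opens (Jet N)}

theorem lineDeriv_congr_on {f : Jet N → ℝ} {g : DiffFun U} (h : ∀ u : U, f u = g.1 u) (u : U)
    (w : Jet N) : lineDeriv ℝ f (u : Jet N) w = lineDeriv ℝ (extFun g.1) (u : Jet N) w := by
  refine Filter.EventuallyEq.deriv_eq ?_
  filter_upwards [eventually_line_mem u w] with t ht
  rw [extFun, dif_pos ht]
  exact h ⟨_, ht⟩

theorem dirDeriv_coordFun (v : Fin N → ℕ → DiffFun U) (i : Fin N) (k : ℕ) :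
    dirDeriv v (coordFun U i k) = v i k := by
  refine Subtype.ext (funext fun u => ?_)
  rw [dirDeriv_apply, ← lineDeriv_congr_on (f := fun u => u i k) (fun _ => rfl)]
  refine HasDerivAt.deriv ?_
  have := ((hasDerivAt_id (0 : ℝ)).mul_const ((v i k).1 u)).const_add ((u : Jet N) i k)
  simpa using this

/-- The total derivative as a derivation of differential functions. -/
noncomputable def dx (U : Opens (Jet N)) : Derivation ℝ (DiffFun U) (DiffFun U) :=
  dirDeriv fun i k => coordFun U i (k + 1)

theorem dx_iterate_coordFun (i : Fin N) (k : ℕ) :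
    (dx U)^[k] (coordFun U i 0) = coordFun U i k := by
  induction k with
  | zero => rfl
  | succ k ih => rw [Function.iterate_succ_apply', ih, dx, dirDeriv_coordFun]

theorem totalD_iterate {f : Jet N → ℝ} {g : DiffFun U} (h : ∀ u : U, f u = g.1 u) (k : ℕ)
    (u : U) : (totalD^[k] f) u = ((dx U)^[k] g).1 u := by
  induction k generalizing u with
  | zero => exact h u
  | succ k ih =>
    rw [Function.iterate_succ_apply', Function.iterate_succ_apply', totalD,
      lineDeriv_congr_on ih, dx, dirDeriv_apply]
    rfl

/-- The derivation along an evolutionary vector field. -/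
noncomputable def evolve (Y : Fin N → DiffFun U) : Derivation ℝ (DiffFun U) (DiffFun U) :=
  dirDeriv fun i k => (dx U)^[k] (Y i)

theorem evolve_coordFun (Y : Fin N → DiffFun U) (i : Fin N) :
    evolve Y (coordFun U i 0) = Y i := by
  rw [evolve, dirDeriv_coordFun]; rfl

theorem evolve_dx (Y : Fin N → DiffFun U) (g : DiffFun U) :
    evolve Y (dx U g) = dx U (evolve Y g) := by
  refine dirDeriv_comm _ _ (fun i k => ?_) g
  rw [dirDeriv_coordFun]
  exact Function.iterate_succ_apply' _ _ _

/-- The directional derivative X'[Y] is the evolutionary derivation of Y applied to the components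
of X, so vanishing brackets reduce to commuting derivations on the undifferentiated coordinates. -/
theorem fieldCommutator_eq {X Y : Fin N → Jet N → ℝ} {X' Y' : Fin N → DiffFun U}
    (hX : ∀ i (u : U), X i u = (X' i).1 u) (hY : ∀ i (u : U), Y i u = (Y' i).1 u)
    (i : Fin N) (u : U) :
    fieldCommutator X Y i u = (evolve Y' (X' i)).1 u - (evolve X' (Y' i)).1 u := by
  have key : ∀ {Z : Fin N → Jet N → ℝ} {Z' : Fin N → DiffFun U},
      (∀ i (u : U), Z i u = (Z' i).1 u) →
      prolong Z (u : Jet N) = fun i k => ((dx U)^[k] (Z' i)).1 u := by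
    intro Z Z' hZ
    funext j k
    exact totalD_iterate (hZ j) k u
  rw [fieldCommutator, key hX, key hY, lineDeriv_congr_on (hX i), lineDeriv_congr_on (hY i)]
  rfl

theorem fieldCommutator_eq_zero {X Y : Fin N → Jet N → ℝ} {X' Y' : Fin N → DiffFun U}
    (hX : ∀ i (u : U), X i u = (X' i).1 u) (hY : ∀ i (u : U), Y i u = (Y' i).1 u) (i : Fin N)
    (h : evolve X' (evolve Y' (coordFun U i 0)) = evolve Y' (evolve X' (coordFun U i 0)))
    (u : U) : fieldCommutator X Y i u = 0 := by
  rw [fieldCommutator_eq hX hY, ← evolve_coordFun X' i, ← evolve_coordFun Y' i, h, sub_self]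

/-- A differential function on `U` as an element of the algebra. -/
theorem IsDifferentialFunctionOn.exists_diffFun {f : Jet N → ℝ}
    (hf : IsDifferentialFunctionOn (U : Set (Jet N)) f) :
    ∃ g : DiffFun U, ∀ u : U, f u = g.1 u := by
  obtain ⟨K, F, hF, h⟩ := hf
  exact ⟨⟨fun u => f u, K, F, hF, fun u => h u u.2⟩, fun _ => rfl⟩

theorem isDifferentialFunctionOn_extFun (g : DiffFun U) :
    IsDifferentialFunctionOn (U : Set (Jet N)) (extFun g.1) := by
  obtain ⟨K, F, hF, h⟩ := g.2
  refine ⟨K, F, hF, fun u hu => ?_⟩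
  rw [extFun_apply g.1 ⟨u, hu⟩, h]

theorem exists_mul_eq_one {g : DiffFun U} (hg : ∀ u, g.1 u ≠ 0) : ∃ h : DiffFun U, g * h = 1 := by
  obtain ⟨K, F, hF, h⟩ := g.2
  refine ⟨⟨fun u => (g.1 u)⁻¹, K, fun y => (F y)⁻¹, hF.inv ?_, fun u => by simp only [h]⟩,
    Subtype.ext (funext fun u => mul_inv_cancel₀ (hg u))⟩
  rintro _ ⟨u, hu, rfl⟩
  rw [← h ⟨u, hu⟩]
  exact hg _

theorem exists_sq_mul_eq_one {g : DiffFun U} (hg : ∀ u, 0 < g.1 u) :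
    ∃ h : DiffFun U, h ^ 2 * g = 1 := by
  obtain ⟨K, F, hF, h⟩ := g.2
  have hne : ∀ y ∈ truncJet K '' (U : Set (Jet N)), 0 < F y := by
    rintro _ ⟨u, hu, rfl⟩
    rw [← h ⟨u, hu⟩]
    exact hg _
  refine ⟨⟨fun u => (Real.sqrt (g.1 u))⁻¹, K, fun y => (Real.sqrt (F y))⁻¹,
    (hF.sqrt fun y hy => (hne y hy).ne').inv fun y hy => (Real.sqrt_pos.2 (hne y hy)).ne',
    fun u => by simp only [h]⟩, Subtype.ext (funext fun u => ?_)⟩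
  change (Real.sqrt (g.1 u))⁻¹ ^ 2 * g.1 u = 1
  rw [inv_pow, Real.sq_sqrt (hg u).le, inv_mul_cancel₀ (hg u).ne']

/-- Evaluation of differential functions at a jet. -/
def evalAt (u : U) : DiffFun U →+* ℝ := (Pi.evalRingHom (fun _ : U => ℝ) u).comp
  (DiffFun U).subtype

@[simp] theorem evalAt_apply (u : U) (g : DiffFun U) : evalAt u g = g.1 u := rfl

end Evolution

/-! ### Generating series of Viète coordinates -/

section Series

variable {R : Type*} [CommRing R] {n : ℕ}

/-- The series `c + v_1 z + ⋯ + v_n z^n`. -/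
noncomputable def vser (c : R) (v : Fin n → R) : R⟦X⟧ :=
  PowerSeries.mk fun i => if i = 0 then c else if h : i - 1 < n then v ⟨i - 1, h⟩ else 0

@[simp] theorem coeff_vser_zero (c : R) (v : Fin n → R) : coeff 0 (vser c v) = c := by
  simp [vser]

@[simp] theorem constantCoeff_vser (c : R) (v : Fin n → R) : constantCoeff (vser c v) = c := by
  rw [← coeff_zero_eq_constantCoeff_apply, coeff_vser_zero]

@[simp] theorem coeff_vser_succ (c : R) (v : Fin n → R) (i : Fin n) :
    coeff ((i : ℕ) + 1) (vser c v) = v i := by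
  simp [vser]

theorem degLT_vser (c : R) (v : Fin n → R) : DegLT (n + 1) (vser c v) := by
  intro k hk
  rw [vser, coeff_mk, if_neg (by omega), dif_neg (by omega)]

theorem coeff_vser_one (q : Fin n → ℝ) (i : ℕ) : coeff i (vser 1 q) = qc q i := by
  simp [vser, qc]

theorem vser_eq_sum (v : Fin n → R) : vser 0 v = ∑ i : Fin n, C (v i) * X ^ ((i : ℕ) + 1) := by
  ext k
  rw [map_sum]
  simp only [coeff_C_mul, coeff_X_pow]
  rcases Nat.eq_zero_or_pos k with rfl | hk
  · simp
  · by_cases h : k - 1 < n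
    · rw [Finset.sum_eq_single (⟨k - 1, h⟩ : Fin n)]
      · have h2 : k = k - 1 + 1 := by omega
        rw [if_pos h2, mul_one]
        conv_lhs => rw [h2]
        exact coeff_vser_succ 0 v ⟨k - 1, h⟩
      · intro b _ hb
        rw [if_neg, mul_zero]
        intro hk2
        apply hb
        ext
        simp [hk2]
      · simp
    · rw [degLT_vser 0 v k (by omega), Finset.sum_eq_zero]
      intro b _
      rw [if_neg (by have := b.2; omega), mul_zero]

theorem map_vser {S : Type*} [CommRing S] (f : R →+* S) (c : R) (v : Fin n → R) :
    PowerSeries.map f (vser c v) = vser (f c) (fun i => f (v i)) := by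
  ext k
  simp only [vser, coeff_map, coeff_mk]
  split_ifs <;> simp

theorem map_refl {S : Type*} [CommRing S] (f : R →+* S) (m : ℕ) (g : R⟦X⟧) :
    PowerSeries.map f (refl m g) = refl m (PowerSeries.map f g) := by
  ext k
  simp only [coeff_map, coeff_refl]
  split_ifs <;> simp

theorem map_cut {S : Type*} [CommRing S] (f : R →+* S) (m : ℕ) (g : R⟦X⟧) :
    PowerSeries.map f (cut m g) = cut m (PowerSeries.map f g) := by
  ext k
  simp only [coeff_map, coeff_cut]
  split_ifs <;> simp

theorem cut_succ (r : ℕ) (f : R⟦X⟧) : cut (r + 1) f = cut r f + C (coeff r f) * X ^ r := by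
  ext k
  rw [map_add, coeff_cut, coeff_cut, coeff_C_mul, coeff_X_pow]
  rcases lt_trichotomy k r with h | rfl | h
  · simp [h, h.ne, Nat.lt_succ_of_lt h]
  · simp
  · simp [h.ne', not_lt.2 h.le, show ¬ k < r + 1 by omega]

end Series

/-! ### Killing tensors -/

section Killing

variable {n : ℕ}

theorem tensorL_mulVec (q w : Fin n → ℝ) (i : Fin n) :
    (tensorL q).mulVec w i =
      (if h : (i : ℕ) + 1 < n then w ⟨i + 1, h⟩ else 0) - q i * w ⟨0, i.pos⟩ := by
  have hi := i.pos
  have : ∀ j : Fin n, tensorL q i j * w j =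
      (if j = ⟨0, i.pos⟩ then - q i * w j else 0) + (if (j : ℕ) = i + 1 then w j else 0) := by
    intro j
    simp only [tensorL, Matrix.of_apply, Fin.ext_iff]
    by_cases h0 : (j : ℕ) = 0
    · simp [h0]
    · simp [h0]
  rw [Matrix.mulVec, dotProduct]
  simp only [this, Finset.sum_add_distrib, Finset.sum_ite_eq', Finset.mem_univ, if_true]
  rw [add_comm, neg_mul, ← sub_eq_add_neg]
  congr 1
  split_ifs with h
  · rw [Finset.sum_eq_single (⟨i + 1, h⟩ : Fin n)]
    · simp
    · intro b _ hb
      rw [if_neg (fun h2 => hb (Fin.ext h2))]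
    · simp
  · apply Finset.sum_eq_zero
    intro b _
    rw [if_neg (by have := b.2; omega)]

/-- On generating series L is a downward shift minus the first component times q. Lengthening the
truncation by one term supplies precisely q_r p - p_r q, where p_r is the first component of K_r p.
-/
theorem killingTensor_mulVec (q p : Fin n → ℝ) (r : ℕ) (i : Fin n) :
    (killingTensor q r).mulVec p i =
      coeff ((i : ℕ) + r) (cut r (vser 1 q) * vser 0 p - cut r (vser 0 p) * vser 1 q) := by
  induction r generalizing i with
  | zero =>
    have : ∀ f : ℝ⟦X⟧, cut 0 f = 0 := fun f => by ext k; simp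
    simp [killingTensor, this]
  | succ r ih =>
    -- The expression is antisymmetric in q and p, so truncations may be exchanged for tails; only
    -- the leading term of the tail of p meets the constant term 1 of q.
    have hZ0 : coeff r (cut r (vser 1 q) * vser 0 p - cut r (vser 0 p) * vser 1 q) =
        coeff r (vser 0 p) := by
      obtain ⟨a, ha⟩ := X_pow_dvd_sub_cut r (vser 1 q)
      obtain ⟨b, hb⟩ := X_pow_dvd_sub_cut r (vser 0 p)
      have e : cut r (vser 1 q) * vser 0 p - cut r (vser 0 p) * vser 1 q =
          X ^ r * (b * vser 1 q - a * vser 0 p) := by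
        rw [eq_comm, ← sub_eq_zero]
        linear_combination (vser 0 p) * ha - (vser 1 q) * hb
      have hb0 := congrArg (coeff r) hb
      rw [map_sub, coeff_cut, if_neg (lt_irrefl r), sub_zero] at hb0
      rw [e, hb0]
      have h0 := coeff_X_pow_mul (b * vser 1 q - a * vser 0 p) r 0
      have h1 := coeff_X_pow_mul b r 0
      rw [zero_add] at h0 h1
      rw [h0, h1]
      simp
    have hstep : coeff ((i : ℕ) + (r + 1)) (cut (r + 1) (vser 1 q) * vser 0 p
        - cut (r + 1) (vser 0 p) * vser 1 q) =
        coeff ((i : ℕ) + 1 + r) (cut r (vser 1 q) * vser 0 p - cut r (vser 0 p) * vser 1 q)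
          + qc q r * p i - coeff r (vser 0 p) * q i := by
      rw [cut_succ, cut_succ, add_mul, add_mul, map_sub, map_add, map_add,
        show (i : ℕ) + (r + 1) = i + 1 + r by ring, mul_assoc, mul_assoc, coeff_C_mul,
        coeff_C_mul, coeff_X_pow_mul, coeff_X_pow_mul, coeff_vser_succ, coeff_vser_succ,
        coeff_vser_one, map_sub]
      ring
    rw [hstep, killingTensor, Matrix.add_mulVec, ← Matrix.mulVec_mulVec, Pi.add_apply,
      tensorL_mulVec, Matrix.smul_mulVec, Matrix.one_mulVec, Pi.smul_apply, smul_eq_mul]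
    have h0 := ih ⟨0, i.pos⟩
    rw [zero_add, hZ0] at h0
    rw [h0]
    have h1 : (if h : (i : ℕ) + 1 < n then (killingTensor q r).mulVec p ⟨i + 1, h⟩ else 0) =
        coeff ((i : ℕ) + 1 + r) (cut r (vser 1 q) * vser 0 p - cut r (vser 0 p) * vser 1 q) := by
      split_ifs with h
      · exact ih ⟨i + 1, h⟩
      · have hd := (((DegLT.cut r (vser 1 q)).mul (degLT_vser 0 p) (p := r + n) le_rfl).sub
          ((DegLT.cut r (vser 0 p)).mul (degLT_vser 1 q) (p := r + n) le_rfl))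
        exact (hd _ (by omega)).symm
    rw [h1]
    ring

end Killing

/-! ### Potentials -/

section Potentials

variable {n : ℕ}

theorem potentialUp_eq (q : Fin n → ℝ) (k r : ℕ) (hr : 1 ≤ r) :
    potentialUp q k r = (if k + r = n then 1 else 0)
      - ∑ j ∈ Finset.range k, qc q (r + j) * potentialUp q (k - 1 - j) 1 := by
  induction k generalizing r with
  | zero => simp [potentialUp]
  | succ k ih =>
    rw [Finset.sum_range_succ', potentialUp]
    by_cases h : r ≤ n
    · rw [if_pos ⟨hr, h⟩, ih (r + 1) (by omega)]
      have : ∀ j ∈ Finset.range k, qc q (r + 1 + j) * potentialUp q (k - 1 - j) 1 =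
          qc q (r + (j + 1)) * potentialUp q (k + 1 - 1 - (j + 1)) 1 := by
        intro j _
        congr 2 <;> omega
      rw [Finset.sum_congr rfl this]
      simp only [add_zero, Nat.add_sub_cancel, Nat.sub_zero]
      rw [show k + (r + 1) = k + 1 + r by ring]
      ring
    · have hq : ∀ l, n < l → qc q l = 0 := by
        intro l hl
        rw [← coeff_vser_one, degLT_vser 1 q l hl]
      rw [if_neg (by omega), if_neg (by omega), hq (r + 0) (by omega), Finset.sum_eq_zero]
      · simp
      · intro j _
        rw [hq _ (by omega), zero_mul]

/-- Unrolling the recursion gives q(z) · Σ V_1^(k) z^k = z^(n-1). -/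
theorem potentialUp_coeff (q : Fin n → ℝ) (hn : 1 ≤ n) (k : ℕ) :
    potentialUp q (n - 1 + k) 1 = coeff k (vser 1 q)⁻¹ := by
  have h : vser 1 q * PowerSeries.mk (fun k => potentialUp q k 1) = X ^ (n - 1) := by
    ext k
    rw [coeff_mul, Finset.Nat.sum_antidiagonal_eq_sum_range_succ
      (fun i j => coeff i (vser 1 q) * coeff j (PowerSeries.mk fun k => potentialUp q k 1)),
      Finset.sum_range_succ', coeff_X_pow]
    simp only [coeff_mk, coeff_vser_zero, one_mul, Nat.sub_zero]
    rw [potentialUp_eq q k 1 le_rfl]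
    have : ∀ j ∈ Finset.range k, coeff (j + 1) (vser 1 q) * potentialUp q (k - (j + 1)) 1 =
        qc q (1 + j) * potentialUp q (k - 1 - j) 1 := by
      intro j _
      rw [coeff_vser_one]
      congr 2 <;> omega
    rw [Finset.sum_congr rfl this, add_sub_cancel]
    split_ifs <;> first | rfl | omega
  have h2 : PowerSeries.mk (fun k => potentialUp q k 1) = X ^ (n - 1) * (vser 1 q)⁻¹ := by
    rw [PowerSeries.eq_mul_inv_iff_mul_eq (by simp), mul_comm, h]
  have h3 := congrArg (coeff (k + (n - 1))) h2
  rw [coeff_X_pow_mul, coeff_mk] at h3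
  rw [add_comm, h3]

/-- In the inverse recursion only V_n feeds back, so it unrolls to a convolution. The guard `j + 1 ≤
r` excludes the negative indices r - 1 - j, which natural subtraction would turn into 0, where q_0 =
1. -/
theorem potentialDown_eq (q : Fin n → ℝ) (k r : ℕ) (hr : r ≤ n) :
    potentialDown q k r = (if r = n + k then 1 else 0)
      - ∑ j ∈ Finset.range k, (if j + 1 ≤ r then qc q (r - 1 - j) else 0) / qc q n
          * potentialDown q (k - 1 - j) n := by
  induction k generalizing r with
  | zero => simp [potentialDown]
  | succ k ih =>
    rw [Finset.sum_range_succ', potentialDown]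
    rcases Nat.eq_zero_or_pos r with rfl | h
    · simp
    · rw [if_pos ⟨h, hr⟩, ih (r - 1) (by omega), if_neg (by omega), if_neg (by omega),
        if_pos (by omega)]
      have : ∀ j ∈ Finset.range k, (if j + 1 ≤ r - 1 then qc q (r - 1 - 1 - j) else 0) / qc q n
            * potentialDown q (k - 1 - j) n =
          (if j + 1 + 1 ≤ r then qc q (r - 1 - (j + 1)) else 0) / qc q n
            * potentialDown q (k + 1 - 1 - (j + 1)) n := by
        intro j _
        rw [show r - 1 - 1 - j = r - 1 - (j + 1) by omega,
          show k + 1 - 1 - (j + 1) = k - 1 - j by omega]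
        congr 2
        split_ifs <;> first | rfl | omega
      rw [Finset.sum_congr rfl this]
      simp only [Nat.add_sub_cancel, Nat.sub_zero]
      ring

theorem constantCoeff_refl_vser {R : Type*} [CommRing R] (c : R) (v : Fin n → R) :
    constantCoeff (refl n (vser c v)) = coeff n (vser c v) := by
  rw [← coeff_zero_eq_constantCoeff_apply, coeff_refl]
  simp

/-- The unrolled recursion for r = n reads Q(z) · Σ V_n^(-k) z^k = q_n with Q the reflection of q.
One more step from r = 1 divides by q_n and brings the sign. -/
theorem potentialDown_coeff (q : Fin n → ℝ) (hn : 1 ≤ n) (hq : qc q n ≠ 0) :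
    potentialDown q n 1 = - coeff (n - 1) (refl n (vser 1 q))⁻¹ := by
  have h : refl n (vser 1 q) * PowerSeries.mk (fun k => potentialDown q k n) = C (qc q n) := by
    ext k
    rw [coeff_mul, Finset.Nat.sum_antidiagonal_eq_sum_range_succ
      (fun i j => coeff i (refl n (vser 1 q)) *
        coeff j (PowerSeries.mk fun k => potentialDown q k n)),
      Finset.sum_range_succ', coeff_C]
    simp only [coeff_mk, coeff_refl, coeff_vser_one, Nat.sub_zero, Nat.zero_le, if_true]
    rw [potentialDown_eq q k n le_rfl, mul_sub, Finset.mul_sum]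
    have : ∀ j ∈ Finset.range k,
        qc q n * ((if j + 1 ≤ n then qc q (n - 1 - j) else 0) / qc q n
          * potentialDown q (k - 1 - j) n) =
        (if j + 1 ≤ n then qc q (n - (j + 1)) else 0) * potentialDown q (k - (j + 1)) n := by
      intro j _
      rw [show n - 1 - j = n - (j + 1) by omega, show k - 1 - j = k - (j + 1) by omega]
      field_simp
    rw [Finset.sum_congr rfl this, add_sub_cancel]
    split_ifs <;> first | omega | simp
  have hc : constantCoeff (refl n (vser 1 q)) ≠ 0 := by
    rwa [constantCoeff_refl_vser, coeff_vser_one]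
  have h2 : PowerSeries.mk (fun k => potentialDown q k n) =
      C (qc q n) * (refl n (vser 1 q))⁻¹ := by
    rw [PowerSeries.eq_mul_inv_iff_mul_eq hc, mul_comm, h]
  have h3 := congrArg (coeff (n - 1)) h2
  rw [coeff_mk, coeff_C_mul] at h3
  obtain ⟨m, rfl⟩ : ∃ m, n = m + 1 := ⟨n - 1, by omega⟩
  rw [potentialDown, if_pos ⟨le_rfl, by omega⟩]
  rw [Nat.add_sub_cancel] at h3 ⊢
  rw [h3, Nat.sub_self, potentialDown_eq q m 0 (by omega), if_neg (by omega)]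
  simp only [qc, if_true]
  rw [Finset.sum_eq_zero (by intro j _; simp)]
  simp only [qc] at hq
  field_simp
  ring

end Potentials

/-! ### The metrics -/

section Metric

variable {n : ℕ}

/-- The contravariant metric `L^(n-s) G^(0)`. -/
noncomputable def blockMetric (s : ℕ) (q : Fin n → ℝ) : Matrix (Fin n) (Fin n) ℝ :=
  Matrix.of fun i j =>
    if (i : ℕ) < s ∧ (j : ℕ) < s then
      if s ≤ (i : ℕ) + j + 1 then qc q ((i : ℕ) + j + 1 - s) else 0
    else if s ≤ (i : ℕ) ∧ s ≤ (j : ℕ) then - qc q ((i : ℕ) + j + 1 - s) else 0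

theorem qc_of_lt (q : Fin n → ℝ) {l : ℕ} (hl : n < l) : qc q l = 0 := by
  rw [← coeff_vser_one, degLT_vser 1 q l hl]

theorem qc_succ (q : Fin n → ℝ) (i : Fin n) : qc q ((i : ℕ) + 1) = q i := by
  rw [← coeff_vser_one, coeff_vser_succ]

/-- L moves the rows up by one and subtracts q times the first row; that row has a single entry 1,
in column s, which thereby passes from the upper block to the lower one. -/
theorem tensorL_mul_blockMetric (s : ℕ) (hs : s + 1 ≤ n) (q : Fin n → ℝ) :
    tensorL q * blockMetric (s + 1) q = blockMetric s q := by
  ext i j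
  have h := tensorL_mulVec q (fun l => blockMetric (s + 1) q l j) i
  have e : (tensorL q * blockMetric (s + 1) q) i j =
      (tensorL q).mulVec (fun l => blockMetric (s + 1) q l j) i := rfl
  rw [e, h]
  have hi := i.2
  have hj := j.2
  have h0 : blockMetric (s + 1) q ⟨0, i.pos⟩ j = if (j : ℕ) = s then 1 else 0 := by
    simp only [blockMetric, Matrix.of_apply]
    by_cases h1 : (j : ℕ) < s + 1
    · rw [if_pos ⟨Nat.succ_pos s, h1⟩]
      by_cases h2 : (j : ℕ) = s
      · rw [if_pos (by omega), if_pos h2]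
        simp [h2, qc]
      · rw [if_neg (by omega), if_neg h2]
    · rw [if_neg (by omega), if_neg (by omega), if_neg (by omega)]
  rw [h0, ← qc_succ q i]
  by_cases h1 : (i : ℕ) + 1 < n
  · rw [dif_pos h1]
    simp only [blockMetric, Matrix.of_apply]
    by_cases hjs : (j : ℕ) = s
    · rw [if_pos hjs]
      by_cases his : (i : ℕ) < s
      · rw [if_pos (by omega), if_pos (by omega), if_neg (by omega), if_neg (by omega),
          show (i : ℕ) + 1 + j + 1 - (s + 1) = i + 1 by omega]
        ring
      · rw [if_neg (by omega), if_neg (by omega), if_neg (by omega), if_pos (by omega),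
          show (i : ℕ) + j + 1 - s = i + 1 by omega]
        ring
    · rw [if_neg hjs, mul_zero, sub_zero]
      have e1 : (i : ℕ) + 1 + j + 1 - (s + 1) = i + j + 1 - s := by omega
      rw [e1]
      split_ifs <;> first | rfl | omega
  · rw [dif_neg h1, zero_sub]
    simp only [blockMetric, Matrix.of_apply]
    by_cases hjs : (j : ℕ) = s
    · rw [if_pos hjs, if_neg (by omega), if_pos (by omega),
        show (i : ℕ) + j + 1 - s = i + 1 by omega, mul_one]
    · rw [if_neg hjs, mul_zero, neg_zero, if_neg (by omega)]
      split_ifs with h2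
      · rw [qc_of_lt q (by omega), neg_zero]
      · rfl

theorem tensorL_pow_mul_metricG0 (m : ℕ) (hm : m ≤ n) (q : Fin n → ℝ) :
    tensorL q ^ m * metricG0 q = blockMetric (n - m) q := by
  induction m with
  | zero =>
    rw [pow_zero, one_mul]
    ext i j
    have hi := i.2
    have hj := j.2
    simp only [metricG0, blockMetric, Matrix.of_apply, Nat.sub_zero, hi, hj, and_self, if_true]
  | succ m ih =>
    rw [pow_succ', mul_assoc, ih (by omega), show n - m = n - (m + 1) + 1 by omega,
      tensorL_mul_blockMetric _ (by omega)]

/-- The entries of the covariant metric as coefficients of power series; the part of index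
greater than `s` is present if `s < n` only. -/
noncomputable def blockMetricInv (s : ℕ) (q : Fin n → ℝ) : Matrix (Fin n) (Fin n) ℝ :=
  Matrix.of fun i j =>
    coeff (s + 1) (X ^ ((i : ℕ) + 1) * X ^ ((j : ℕ) + 1) * (vser 1 q)⁻¹)
      - if s < n then
          coeff (n - s - 1) (X ^ (n - 1 - (i : ℕ)) * X ^ (n - 1 - (j : ℕ))
            * (refl n (vser 1 q))⁻¹)
        else 0

theorem sum_upper_column (s : ℕ) (hs : s ≤ n) (q : Fin n → ℝ) (k : Fin n) (hk : (k : ℕ) < s) :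
    ∑ j : Fin n, C (blockMetric s q j k) * X ^ ((j : ℕ) + 1) =
      X ^ (s - (k : ℕ)) * cut ((k : ℕ) + 1) (vser 1 q) := by
  rw [← vser_eq_sum]
  ext l
  rw [coeff_X_pow_mul', coeff_cut, coeff_vser_one]
  rcases Nat.eq_zero_or_pos l with rfl | hl
  · rw [if_neg (by omega), coeff_vser_zero]
  · by_cases hln : l - 1 < n
    · have h1 := coeff_vser_succ (0 : ℝ) (fun j => blockMetric s q j k) ⟨l - 1, hln⟩
      simp only [Nat.sub_add_cancel hl] at h1
      rw [h1]
      simp only [blockMetric, Matrix.of_apply]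
      rw [show l - 1 + (k : ℕ) + 1 - s = l - (s - k) by omega]
      split_ifs <;> first | rfl | omega
    · rw [degLT_vser _ _ l (by omega)]
      split_ifs <;> first | rfl | omega

theorem sum_refl (v : Fin n → ℝ) :
    refl n (vser 0 v) = ∑ j : Fin n, C (v j) * X ^ (n - 1 - (j : ℕ)) := by
  ext l
  rw [coeff_refl, map_sum]
  simp only [coeff_C_mul, coeff_X_pow]
  by_cases h : l < n
  · rw [if_pos h.le, Finset.sum_eq_single (⟨n - 1 - l, by omega⟩ : Fin n)]
    · have h1 := coeff_vser_succ (0 : ℝ) v ⟨n - 1 - l, by omega⟩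
      simp only at h1
      rw [show n - l = n - 1 - l + 1 by omega, h1, if_pos (by simp only; omega), mul_one]
    · intro b _ hb
      rw [if_neg, mul_zero]
      intro h2
      apply hb
      ext
      simp only
      omega
    · simp
  · rw [Finset.sum_eq_zero]
    · split_ifs with h2
      · rw [show n - l = 0 by omega, coeff_vser_zero]
      · rfl
    · intro b _
      have := b.2
      rw [if_neg (by omega), mul_zero]

theorem sum_lower_column (s : ℕ) (q : Fin n → ℝ) (k : Fin n) (hk : s ≤ (k : ℕ)) :
    ∑ j : Fin n, C (blockMetric s q j k) * X ^ (n - 1 - (j : ℕ)) =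
      - (X ^ ((k : ℕ) - s) * cut (n - (k : ℕ)) (refl n (vser 1 q))) := by
  have hkn := k.2
  rw [← sum_refl]
  ext l
  rw [map_neg, coeff_X_pow_mul', coeff_cut, coeff_refl, coeff_refl, coeff_vser_one]
  by_cases hl : l < n
  · have h1 := coeff_vser_succ (0 : ℝ) (fun j => blockMetric s q j k) ⟨n - 1 - l, by omega⟩
    simp only at h1
    rw [if_pos hl.le, show n - l = n - 1 - l + 1 by omega, h1]
    simp only [blockMetric, Matrix.of_apply]
    rw [if_neg (by omega)]
    by_cases h2 : (k : ℕ) - s ≤ l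
    · rw [if_pos h2, if_pos (show l - ((k : ℕ) - s) ≤ n by omega),
        show n - 1 - l + (k : ℕ) + 1 - s = n - (l - (k - s)) by omega]
      split_ifs <;> first | rfl | omega | simp
    · rw [if_neg h2, neg_zero]
      split_ifs
      · rw [qc_of_lt q (by omega), neg_zero]
      · rfl
  · have h3 : (if l ≤ n then coeff (n - l) (vser 0 fun j => blockMetric s q j k) else 0) = 0 := by
      split_ifs with h4
      · rw [show n - l = 0 by omega, coeff_vser_zero]
      · rfl
    rw [h3]
    split_ifs <;> first | omega | simp

/-- A truncation of f divided by f is 1 up to the truncation order. -/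
theorem coeff_mul_cut_inv {f : ℝ⟦X⟧} (hf : constantCoeff f ≠ 0) (a r l : ℕ) (h : l < a + r) :
    coeff l (X ^ a * cut r f * f⁻¹) = if l = a then 1 else 0 := by
  obtain ⟨g, hg⟩ := X_pow_dvd_sub_cut r f
  have : X ^ a * cut r f * f⁻¹ = X ^ a - X ^ (a + r) * (g * f⁻¹) := by
    rw [pow_add]
    linear_combination (-(X ^ a * f⁻¹)) * hg + X ^ a * PowerSeries.mul_inv_cancel f hf
  rw [this, map_sub, coeff_X_pow, coeff_X_pow_mul', if_neg (not_le.2 h), sub_zero]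

theorem sum_coeff_mul (l : ℕ) (f g : ℝ⟦X⟧) (a : Fin n → ℝ⟦X⟧) (c : Fin n → ℝ) :
    ∑ j, coeff l (f * a j * g) * c j = coeff l (f * (∑ j, C (c j) * a j) * g) := by
  rw [Finset.mul_sum, Finset.sum_mul, map_sum]
  refine Finset.sum_congr rfl fun j _ => ?_
  rw [show f * (C (c j) * a j) * g = C (c j) * (f * a j * g) by ring, coeff_C_mul, mul_comm]

/-- Each column of the block metric is a shifted truncation of q or of its reflection, so dividing
by the full series leaves one monomial in the relevant orders. The other block contributes only
orders that are too high. -/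
theorem blockMetricInv_mul (s : ℕ) (hs : s ≤ n) (q : Fin n → ℝ) (hq : s < n → qc q n ≠ 0) :
    blockMetricInv s q * blockMetric s q = 1 := by
  ext i k
  have hi := i.2
  have hk := k.2
  rw [Matrix.mul_apply, Matrix.one_apply]
  simp only [blockMetricInv, Matrix.of_apply, sub_mul, Finset.sum_sub_distrib]
  rw [sum_coeff_mul]
  have hlow : (∑ j : Fin n, (if s < n then coeff (n - s - 1) (X ^ (n - 1 - (i : ℕ))
      * X ^ (n - 1 - (j : ℕ)) * (refl n (vser 1 q))⁻¹) else 0) * blockMetric s q j k) =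
      if s < n then coeff (n - s - 1) (X ^ (n - 1 - (i : ℕ)) *
        (∑ j : Fin n, C (blockMetric s q j k) * X ^ (n - 1 - (j : ℕ)))
          * (refl n (vser 1 q))⁻¹) else 0 := by
    split_ifs
    · rw [sum_coeff_mul]
    · simp
  rw [hlow]
  by_cases hks : (k : ℕ) < s
  · rw [sum_upper_column s hs q k hks, ← mul_assoc, ← pow_add,
      coeff_mul_cut_inv (by simp) _ _ _ (by omega)]
    have : (if s < n then coeff (n - s - 1) (X ^ (n - 1 - (i : ℕ)) *
        (∑ j : Fin n, C (blockMetric s q j k) * X ^ (n - 1 - (j : ℕ)))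
          * (refl n (vser 1 q))⁻¹) else 0) = 0 := by
      split_ifs with hsn
      · have hd : X ^ (n - s) ∣ ∑ j : Fin n, C (blockMetric s q j k) * X ^ (n - 1 - (j : ℕ)) := by
          refine Finset.dvd_sum fun j _ => ?_
          by_cases hj : (j : ℕ) < s
          · exact (pow_dvd_pow X (by omega)).mul_left _
          · have : blockMetric s q j k = 0 := by
              simp only [blockMetric, Matrix.of_apply]
              rw [if_neg (by omega), if_neg (by omega)]
            rw [this, map_zero, zero_mul]
            exact dvd_zero _
        exact X_pow_dvd_iff.1 ((hd.mul_left _).mul_right _) _ (by omega)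
      · rfl
    rw [this, sub_zero]
    simp only [Fin.ext_iff]
    split_ifs <;> first | rfl | omega
  · have hsn : s < n := by omega
    rw [if_pos hsn, sum_lower_column s q k (by omega), mul_neg, neg_mul, map_neg, sub_neg_eq_add,
      ← mul_assoc, ← pow_add,
      coeff_mul_cut_inv (by rw [constantCoeff_refl_vser, coeff_vser_one]; exact hq hsn) _ _ _
        (by omega)]
    have hd : X ^ (s + 1) ∣ ∑ j : Fin n, C (blockMetric s q j k) * X ^ ((j : ℕ) + 1) := by
      refine Finset.dvd_sum fun j _ => ?_
      by_cases hj : (j : ℕ) < s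
      · have : blockMetric s q j k = 0 := by
          simp only [blockMetric, Matrix.of_apply]
          rw [if_neg (by omega), if_neg (by omega)]
        rw [this, map_zero, zero_mul]
        exact dvd_zero _
      · exact (pow_dvd_pow X (by omega)).mul_left _
    have hd2 : X ^ (s + 1 + 1) ∣ X ^ ((i : ℕ) + 1) *
        ∑ j : Fin n, C (blockMetric s q j k) * X ^ ((j : ℕ) + 1) := by
      rw [pow_succ']
      exact mul_dvd_mul (dvd_pow_self _ (by omega)) hd
    rw [X_pow_dvd_iff.1 (hd2.mul_right _) _ (by omega), zero_add]
    simp only [Fin.ext_iff]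
    split_ifs <;> first | rfl | omega

theorem metric_eq (s : ℕ) (hs : s ≤ n) (q : Fin n → ℝ) (hq : s < n → qc q n ≠ 0) :
    metric ((n : ℤ) - s) q = blockMetricInv s q := by
  rw [metric, show (n : ℤ) - s = ((n - s : ℕ) : ℤ) by omega, zpow_natCast,
    tensorL_pow_mul_metricG0 _ (by omega), Nat.sub_sub_self hs]
  exact Matrix.inv_eq_left_inv (blockMetricInv_mul s hs q hq)

/-- The kinetic energy as a coefficient of power series. -/
theorem sum_metric (s : ℕ) (hs : s ≤ n) (q p : Fin n → ℝ) (hq : s < n → qc q n ≠ 0) :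
    ∑ i, ∑ j, p i * metric ((n : ℤ) - s) q i j * p j =
      coeff (s + 1) (vser 0 p ^ 2 * (vser 1 q)⁻¹)
        - if s < n then coeff (n - s - 1) (refl n (vser 0 p) ^ 2 * (refl n (vser 1 q))⁻¹)
          else 0 := by
  have key : ∀ (l : ℕ) (a : Fin n → ℝ⟦X⟧) (g : ℝ⟦X⟧),
      ∑ i, ∑ j, p i * coeff l (a i * a j * g) * p j =
        coeff l ((∑ i, C (p i) * a i) ^ 2 * g) := by
    intro l a g
    have : ∀ i, ∑ j, p i * coeff l (a i * a j * g) * p j =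
        coeff l (1 * a i * ((∑ j, C (p j) * a j) * g)) * p i := by
      intro i
      simp only [mul_assoc (p i), ← Finset.mul_sum]
      rw [sum_coeff_mul, one_mul, mul_assoc, mul_comm]
    simp only [this]
    rw [sum_coeff_mul, one_mul, pow_two, mul_assoc]
  rw [metric_eq s hs q hq, sum_refl, vser_eq_sum p, ← key, ← key]
  simp only [blockMetricInv, Matrix.of_apply]
  split_ifs
  · rw [← Finset.sum_sub_distrib]
    refine Finset.sum_congr rfl fun i _ => ?_
    rw [← Finset.sum_sub_distrib]
    refine Finset.sum_congr rfl fun j _ => ?_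
    ring
  · simp only [sub_zero]

end Metric

/-! ### Curves of power series -/

/-- The curve `f` of power series has the coefficientwise derivative `f'` at `0`. -/
def HasSerDeriv (f : ℝ → ℝ⟦X⟧) (f' : ℝ⟦X⟧) : Prop :=
  ∀ m, HasDerivAt (fun t => coeff m (f t)) (coeff m f') 0

theorem HasSerDeriv.mul {f g : ℝ → ℝ⟦X⟧} {f' g' : ℝ⟦X⟧} (hf : HasSerDeriv f f')
    (hg : HasSerDeriv g g') : HasSerDeriv (fun t => f t * g t) (f' * g 0 + f 0 * g') := by
  intro m
  simp only [coeff_mul, map_add, ← Finset.sum_add_distrib]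
  exact HasDerivAt.fun_sum fun p _ => (hf p.1).mul (hg p.2)

theorem HasSerDeriv.line (a b : ℝ⟦X⟧) : HasSerDeriv (fun t => a + t • b) b := by
  intro m
  have h := ((hasDerivAt_id (0 : ℝ)).mul_const (coeff m b)).const_add (coeff m a)
  simpa using h

/-- Differentiability follows from the recursion for the coefficients of an inverse; the value then
comes from differentiating f · f⁻¹ = 1. -/
theorem HasSerDeriv.inv {f : ℝ → ℝ⟦X⟧} {f' : ℝ⟦X⟧} (hf : HasSerDeriv f f')
    (h0 : constantCoeff (f 0) ≠ 0) :
    HasSerDeriv (fun t => (f t)⁻¹) (- f' * (f 0)⁻¹ ^ 2) := by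
  have hc : HasDerivAt (fun t => constantCoeff (f t)) (constantCoeff f') 0 := by
    simpa only [coeff_zero_eq_constantCoeff_apply] using hf 0
  have hdiff : ∀ m, DifferentiableAt ℝ (fun t => coeff m (f t)⁻¹) 0 := by
    intro m
    induction m using Nat.strong_induction_on with
    | _ m ih =>
      rw [show (fun t => coeff m (f t)⁻¹) = _ from funext fun t => PowerSeries.coeff_inv m (f t)]
      by_cases hm : m = 0
      · simp only [hm, if_true]
        exact hc.differentiableAt.inv h0
      · simp only [hm, if_false]
        refine (hc.differentiableAt.inv h0).neg.mul (DifferentiableAt.fun_sum fun p _ => ?_)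
        by_cases hp : p.2 < m
        · simp only [hp, if_true]
          exact (hf p.1).differentiableAt.mul (ih p.2 hp)
        · simp only [hp, if_false]
          exact differentiableAt_const _
  set d : ℝ⟦X⟧ := PowerSeries.mk fun m => deriv (fun t => coeff m (f t)⁻¹) 0 with hd
  have hinv : HasSerDeriv (fun t => (f t)⁻¹) d := by
    intro m
    rw [hd, coeff_mk]
    exact (hdiff m).hasDerivAt
  have hprod : f' * (f 0)⁻¹ + f 0 * d = 0 := by
    ext m
    have h1 := hf.mul hinv m
    have h2 : HasDerivAt (fun t => coeff m (f t * (f t)⁻¹)) 0 0 := by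
      refine (hasDerivAt_const (0 : ℝ) (coeff m (1 : ℝ⟦X⟧))).congr_of_eventuallyEq ?_
      filter_upwards [hc.continuousAt.eventually_ne h0] with t ht
      rw [PowerSeries.mul_inv_cancel _ ht]
    rw [map_zero]
    exact h1.unique h2
  have : d = - f' * (f 0)⁻¹ ^ 2 := by
    linear_combination (f 0)⁻¹ * hprod - d * PowerSeries.mul_inv_cancel _ h0
  rwa [← this]

/-! ### Euler–Lagrange operators of first order densities -/

section Euler

variable {n : ℕ}

/-- On `D` the density `f` has the partial derivatives `p₀`, `p₁` with respect to the field of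
index `i` and its first derivative, and `val = p₀ - d p₁ / dx`. -/
def HasEuler (D : Set (Jet n)) (i : Fin n) (f val : Jet n → ℝ) : Prop :=
  ∃ p₀ p₁ p₂ : Jet n → ℝ, ∀ u ∈ D,
    HasLineDerivAt ℝ f (p₀ u) u (Pi.single i (Pi.single 0 1)) ∧
    HasLineDerivAt ℝ f (p₁ u) u (Pi.single i (Pi.single 1 1)) ∧
    HasLineDerivAt ℝ p₁ (p₂ u) u (fun j k => u j (k + 1)) ∧ val u = p₀ u - p₂ u

theorem HasEuler.add {D : Set (Jet n)} {i : Fin n} {f g a b : Jet n → ℝ} (hf : HasEuler D i f a)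
    (hg : HasEuler D i g b) : HasEuler D i (fun u => f u + g u) (fun u => a u + b u) := by
  obtain ⟨p₀, p₁, p₂, hp⟩ := hf
  obtain ⟨r₀, r₁, r₂, hr⟩ := hg
  refine ⟨fun u => p₀ u + r₀ u, fun u => p₁ u + r₁ u, fun u => p₂ u + r₂ u, fun u hu => ?_⟩
  obtain ⟨h1, h2, h3, h4⟩ := hp u hu
  obtain ⟨k1, k2, k3, k4⟩ := hr u hu
  exact ⟨HasDerivAt.fun_add h1 k1, HasDerivAt.fun_add h2 k2, HasDerivAt.fun_add h3 k3,
    by simp only [h4, k4]; ring⟩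

theorem HasEuler.const_mul {D : Set (Jet n)} {i : Fin n} {f a : Jet n → ℝ} (c : ℝ)
    (hf : HasEuler D i f a) : HasEuler D i (fun u => c * f u) (fun u => c * a u) := by
  obtain ⟨p₀, p₁, p₂, hp⟩ := hf
  refine ⟨fun u => c * p₀ u, fun u => c * p₁ u, fun u => c * p₂ u, fun u hu => ?_⟩
  obtain ⟨h1, h2, h3, h4⟩ := hp u hu
  exact ⟨HasDerivAt.const_mul c h1, HasDerivAt.const_mul c h2, HasDerivAt.const_mul c h3,
    by simp only [h4]; ring⟩

/-- Only the terms k = 0, 1 survive. Independence of higher derivatives is required at every jet,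
not just on D, so that those partial derivatives vanish as functions and so do their total
derivatives. -/
theorem HasEuler.euler_eq {D : Set (Jet n)} {i : Fin n} {f val ℒ : Jet n → ℝ}
    (hD : ∀ u ∈ D, ∀ w : Jet n, ∀ᶠ t : ℝ in nhds 0, u + t • w ∈ D) (hf : HasEuler D i f val)
    (hℒ : ∀ u ∈ D, ℒ u = f u)
    (hord : ∀ (u : Jet n) (k : ℕ) (t : ℝ), 2 ≤ k →
      ℒ (u + t • (Pi.single i (Pi.single k 1) : Jet n)) = ℒ u)
    {u : Jet n} (hu : u ∈ D) : euler i ℒ u = val u := by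
  obtain ⟨p₀, p₁, p₂, hp⟩ := hf
  have hjet : ∀ k, 2 ≤ k → jetPartial i k ℒ = 0 := by
    intro k hk
    funext v
    refine HasDerivAt.deriv ?_
    simp only [hord v k _ hk]
    exact hasDerivAt_const _ _
  have hzero : ∀ k, totalD^[k] (0 : Jet n → ℝ) = 0 := by
    intro k
    induction k with
    | zero => rfl
    | succ k ih =>
      rw [Function.iterate_succ_apply', ih]
      funext v
      exact HasDerivAt.deriv (hasDerivAt_const _ _)
  have hpart : ∀ {v : Jet n} (_ : v ∈ D) (w : Jet n) (c : ℝ), HasLineDerivAt ℝ f c v w →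
      lineDeriv ℝ ℒ v w = c := by
    intro v hv w c h
    refine HasDerivAt.deriv (HasDerivAt.congr_of_eventuallyEq h ?_)
    filter_upwards [hD v hv w] with t ht
    exact hℒ _ ht
  rw [euler, finsum_eq_sum_of_support_subset (s := Finset.range 2)]
  · rw [Finset.sum_range_succ, Finset.sum_range_one, (hp u hu).2.2.2]
    have h0 : jetPartial i 0 ℒ u = p₀ u := hpart hu _ _ (hp u hu).1
    have h1 : totalD (jetPartial i 1 ℒ) u = p₂ u := by
      refine HasDerivAt.deriv (HasDerivAt.congr_of_eventuallyEq (hp u hu).2.2.1 ?_)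
      filter_upwards [hD u hu _] with t ht
      exact hpart ht _ _ (hp _ ht).2.1
    simp only [Function.iterate_zero, Function.iterate_one, id_eq, h0, h1]
    ring
  · intro k hk
    rw [Finset.coe_range, Set.mem_Iio]
    by_contra h
    apply hk
    dsimp only
    rw [hjet k (by omega), hzero]
    simp

/-- The generating series of the derivatives of order `k` of the Viète coordinates. -/
noncomputable def jser (u : Jet n) (k : ℕ) : ℝ⟦X⟧ :=
  vser (if k = 0 then 1 else 0) fun i => u i k

theorem vser_add_smul (c t : ℝ) (v w : Fin n → ℝ) :
    vser c (v + t • w) = vser c v + t • vser 0 w := by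
  ext k
  simp only [vser, map_add, coeff_mk]
  have : coeff k (t • PowerSeries.mk fun i => if i = 0 then (0 : ℝ) else
      if h : i - 1 < n then w ⟨i - 1, h⟩ else 0) = t * (if k = 0 then (0 : ℝ) else
      if h : k - 1 < n then w ⟨k - 1, h⟩ else 0) := by
    rw [PowerSeries.coeff_smul, coeff_mk, smul_eq_mul]
  rw [this]
  split_ifs <;> simp

theorem jser_line (u w : Jet n) (t : ℝ) (k : ℕ) :
    jser (u + t • w) k = jser u k + t • vser 0 fun i => w i k :=
  vser_add_smul _ t (fun i => u i k) fun i => w i k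

theorem vser_single (i : Fin n) : vser 0 (Pi.single i (1 : ℝ)) = X ^ ((i : ℕ) + 1) := by
  rw [vser_eq_sum, Finset.sum_eq_single i]
  · simp
  · intro b _ hb
    simp [hb]
  · simp

theorem vser_zero : vser 0 (0 : Fin n → ℝ) = 0 := by
  rw [vser_eq_sum]; simp

theorem single_jet_same (i : Fin n) (k : ℕ) :
    (fun j => (Pi.single i (Pi.single k 1) : Jet n) j k) = Pi.single i (1 : ℝ) := by
  funext j
  by_cases h : j = i
  · subst h; simp
  · simp [h]

theorem single_jet_ne (i : Fin n) {k l : ℕ} (h : l ≠ k) :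
    (fun j => (Pi.single i (Pi.single k 1) : Jet n) j l) = 0 := by
  funext j
  by_cases hj : j = i
  · subst hj; simp [h]
  · simp [hj]

theorem hasSerDeriv_jser (φ : ℝ⟦X⟧ →ₗ[ℝ] ℝ⟦X⟧) (u w : Jet n) (k : ℕ) :
    HasSerDeriv (fun t => φ (jser (u + t • w) k)) (φ (vser 0 fun i => w i k)) := by
  simp only [jser_line, map_add, map_smul]
  exact HasSerDeriv.line _ _

theorem hasSerDeriv_jser_inv (φ : ℝ⟦X⟧ →ₗ[ℝ] ℝ⟦X⟧) {u : Jet n}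
    (hu : constantCoeff (φ (jser u 0)) ≠ 0) (w : Jet n) :
    HasSerDeriv (fun t => (φ (jser (u + t • w) 0))⁻¹)
      (- φ (vser 0 fun i => w i 0) * (φ (jser u 0))⁻¹ ^ 2) := by
  have h := (hasSerDeriv_jser φ u w 0).inv (by simpa using hu)
  simpa using h

theorem hasEuler_inv (φ : ℝ⟦X⟧ →ₗ[ℝ] ℝ⟦X⟧) {D : Set (Jet n)}
    (hD : ∀ u ∈ D, constantCoeff (φ (jser u 0)) ≠ 0) (i : Fin n) (m : ℕ) :
    HasEuler D i (fun u => coeff m (φ (jser u 0))⁻¹)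
      (fun u => - coeff m (φ (X ^ ((i : ℕ) + 1)) * (φ (jser u 0))⁻¹ ^ 2)) := by
  refine ⟨_, fun _ => 0, fun _ => 0, fun u hu => ⟨?_, ?_, hasDerivAt_const _ _,
    (sub_zero _).symm⟩⟩
  · have h := hasSerDeriv_jser_inv φ (hD u hu) (Pi.single i (Pi.single 0 1)) m
    rw [single_jet_same, vser_single, neg_mul, map_neg] at h
    exact h
  · have h := hasSerDeriv_jser_inv φ (hD u hu) (Pi.single i (Pi.single 1 1)) m
    rw [single_jet_ne i zero_ne_one, vser_zero, map_zero, neg_zero, zero_mul, map_zero] at h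
    exact h

/-- The linear map φ is the identity or the reflection, so one computation serves the two blocks of
the metric; φ(z^(i+1)) is the variation of the series in the direction of the i-th field. -/
theorem hasEuler_kinetic (φ : ℝ⟦X⟧ →ₗ[ℝ] ℝ⟦X⟧) {D : Set (Jet n)}
    (hD : ∀ u ∈ D, constantCoeff (φ (jser u 0)) ≠ 0) (i : Fin n) (m : ℕ) :
    HasEuler D i (fun u => coeff m (φ (jser u 1) ^ 2 * (φ (jser u 0))⁻¹))
      (fun u => coeff m (φ (X ^ ((i : ℕ) + 1)) *
        (φ (jser u 1) ^ 2 * (φ (jser u 0))⁻¹ ^ 2 - 2 * φ (jser u 2) * (φ (jser u 0))⁻¹))) := by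
  refine ⟨fun u => coeff m (φ (jser u 1) ^ 2 * (- φ (X ^ ((i : ℕ) + 1)) * (φ (jser u 0))⁻¹ ^ 2)),
    fun u => coeff m (φ (X ^ ((i : ℕ) + 1)) * (2 * φ (jser u 1)) * (φ (jser u 0))⁻¹),
    fun u => coeff m (φ (X ^ ((i : ℕ) + 1)) * (2 * φ (jser u 2) * (φ (jser u 0))⁻¹
      - 2 * φ (jser u 1) ^ 2 * (φ (jser u 0))⁻¹ ^ 2)), fun u hu => ⟨?_, ?_, ?_, ?_⟩⟩
  · have h1 := hasSerDeriv_jser φ u (Pi.single i (Pi.single 0 1)) 1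
    have h0 := hasSerDeriv_jser_inv φ (hD u hu) (Pi.single i (Pi.single 0 1))
    have h := ((h1.mul h1).mul h0) m
    rw [single_jet_ne i one_ne_zero, single_jet_same, vser_zero, vser_single] at h
    simp only [map_zero, zero_mul, mul_zero, add_zero, zero_smul, zero_add, ← pow_two] at h
    exact h
  · have h1 := hasSerDeriv_jser φ u (Pi.single i (Pi.single 1 1)) 1
    have h0 := hasSerDeriv_jser_inv φ (hD u hu) (Pi.single i (Pi.single 1 1))
    have h := ((h1.mul h1).mul h0) m
    rw [single_jet_ne i zero_ne_one, single_jet_same, vser_zero, vser_single] at h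
    simp only [map_zero, neg_zero, zero_mul, mul_zero, add_zero, zero_smul, ← pow_two] at h
    refine HasDerivAt.congr_deriv h ?_
    congr 1
    ring
  · have h1 := hasSerDeriv_jser φ u (fun j k => u j (k + 1)) 1
    have h0 := hasSerDeriv_jser_inv φ (hD u hu) (fun j k => u j (k + 1))
    have hc : HasSerDeriv (fun _ : ℝ => φ (X ^ ((i : ℕ) + 1)) * 2) 0 := by
      intro m
      rw [map_zero]
      exact hasDerivAt_const _ _
    have h := (hc.mul (h1.mul h0)) m
    have e1 : vser 0 (fun i : Fin n => u i (1 + 1)) = jser u 2 := by simp [jser]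
    have e0 : vser 0 (fun i : Fin n => u i (0 + 1)) = jser u 1 := by simp [jser]
    rw [e1, e0] at h
    simp only [zero_smul, add_zero, zero_mul, zero_add] at h
    refine HasDerivAt.congr_deriv (HasDerivAt.congr_of_eventuallyEq h
      (Filter.Eventually.of_forall fun t => ?_)) ?_
    · dsimp only
      congr 1
      ring
    · dsimp only
      congr 1
      ring
  · dsimp only
    rw [← map_sub]
    congr 1
    ring

end Euler

/-! ### The two Lagrangians and their Euler–Lagrange expressions. -/

section Densities

variable {n : ℕ}

/-- The reflection as a linear map. -/
noncomputable def reflLin (m : ℕ) : ℝ⟦X⟧ →ₗ[ℝ] ℝ⟦X⟧ where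
  toFun := refl m
  map_add' := refl_add m
  map_smul' := fun c f => by
    ext k
    simp only [coeff_refl, PowerSeries.coeff_smul, RingHom.id_apply]
    split_ifs <;> simp

theorem refl_X_pow_succ (i : Fin n) :
    refl n (X ^ ((i : ℕ) + 1) : ℝ⟦X⟧) = X ^ (n - 1 - (i : ℕ)) := by
  have := i.2
  ext k
  rw [coeff_refl, coeff_X_pow, coeff_X_pow]
  split_ifs <;> first | rfl | omega

/-- The value of `(h')² / 2 - h h''` on the jet of a series. -/
noncomputable def quadVal (h h' h'' : ℝ⟦X⟧) : ℝ⟦X⟧ := (1 / 2 : ℝ) • h' ^ 2 - h * h''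

theorem half_smul_kinetic {a h h' h'' : ℝ⟦X⟧} (hh : constantCoeff h ≠ 0) (m : ℕ) :
    (1 / 2 : ℝ) * coeff m (a * (h' ^ 2 * h⁻¹ ^ 2 - 2 * h'' * h⁻¹)) =
      coeff m (a * (quadVal h h' h'' * h⁻¹ ^ 2)) := by
  have h1 : (1 / 2 : ℝ) • (a * (h' ^ 2 * h⁻¹ ^ 2 - 2 * h'' * h⁻¹)) =
      a * (quadVal h h' h'' * h⁻¹ ^ 2) := by
    apply smul_half_cancel
    have h2 : ∀ b : ℝ⟦X⟧, 2 * ((1 / 2 : ℝ) • b) = b := by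
      intro b
      ext k
      rw [two_mul, map_add, PowerSeries.coeff_smul, smul_eq_mul]
      ring
    rw [h2]
    have h3 : 2 * quadVal h h' h'' = h' ^ 2 - 2 * (h * h'') := by
      rw [quadVal, mul_sub, h2]
    linear_combination (-(a * h⁻¹ ^ 2)) * h3
      + (2 * a * h'' * h⁻¹) * PowerSeries.mul_inv_cancel h hh
  rw [← h1, PowerSeries.coeff_smul, smul_eq_mul]

theorem lagrangian_order (m k : ℤ) (i : Fin n) (u : Jet n) (l : ℕ) (t : ℝ) (hl : 2 ≤ l) :
    lagrangian n m k (u + t • (Pi.single i (Pi.single l 1) : Jet n)) = lagrangian n m k u := by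
  have h : ∀ j, ∀ p, p < 2 → (u + t • (Pi.single i (Pi.single l 1) : Jet n)) j p = u j p := by
    intro j p hp
    have := congrFun (single_jet_ne i (show p ≠ l by omega)) j
    simp only [Pi.add_apply, Pi.smul_apply]
    rw [this]
    simp
  simp only [lagrangian, h _ 0 (by norm_num), h _ 1 (by norm_num)]

theorem jser_zero (u : Jet n) : jser u 0 = vser 1 fun i => u i 0 := by simp [jser]

theorem jser_one (u : Jet n) : jser u 1 = vser 0 fun i => u i 1 := by simp [jser]

theorem constantCoeff_jser_zero (u : Jet n) : constantCoeff (jser u 0) ≠ 0 := by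
  simp [jser_zero]

theorem lagrangian_positive (hn : 1 ≤ n) (σ : ℕ) (u : Jet n) :
    lagrangian n 0 (2 * n + σ) u =
      (1 / 2) * coeff (n + 1) (jser u 1 ^ 2 * (jser u 0)⁻¹)
        + (-1) * coeff (n + σ + 1) (jser u 0)⁻¹ := by
  have hpot : potential (2 * n + σ) 1 (fun l => u l 0) =
      coeff (n + σ + 1) (vser 1 fun l => u l 0)⁻¹ := by
    rw [← potentialUp_coeff _ hn, show n - 1 + (n + σ + 1) = 2 * n + σ by omega]
    rfl
  have hkin := sum_metric n le_rfl (fun l => u l 0) (fun l => u l 1) (fun h => absurd h (by simp))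
  rw [sub_self, if_neg (lt_irrefl n), sub_zero] at hkin
  rw [lagrangian, hpot, hkin, jser_zero, jser_one]
  ring

theorem euler_positive (hn : 1 ≤ n) (σ : ℕ) (i : Fin n) (u : Jet n) :
    euler i (lagrangian n 0 (2 * n + σ)) u =
      coeff (n + σ - i) ((1 + X ^ σ * quadVal (jser u 0) (jser u 1) (jser u 2))
        * (jser u 0)⁻¹ ^ 2) := by
  have hD : ∀ v ∈ (Set.univ : Set (Jet n)),
      constantCoeff ((LinearMap.id : ℝ⟦X⟧ →ₗ[ℝ] ℝ⟦X⟧) (jser v 0)) ≠ 0 :=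
    fun v _ => constantCoeff_jser_zero v
  have hE := ((hasEuler_kinetic LinearMap.id hD i (n + 1)).const_mul (1 / 2)).add
    ((hasEuler_inv LinearMap.id hD i (n + σ + 1)).const_mul (-1))
  rw [hE.euler_eq (fun _ _ _ => Filter.Eventually.of_forall fun _ => Set.mem_univ _)
    (fun v _ => lagrangian_positive hn σ v) (fun v k t hk => lagrangian_order _ _ i v k t hk)
    (Set.mem_univ u)]
  simp only [LinearMap.id_apply]
  have hi := i.2
  rw [half_smul_kinetic (constantCoeff_jser_zero u), neg_one_mul, neg_neg, add_mul, one_mul,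
    map_add, coeff_X_pow_mul', coeff_X_pow_mul', if_pos (by omega), if_pos (by omega),
    mul_assoc (X ^ σ), coeff_X_pow_mul', if_pos (by omega),
    show n + 1 - ((i : ℕ) + 1) = n + σ - i - σ by omega,
    show n + σ + 1 - ((i : ℕ) + 1) = n + σ - i by omega]
  ring

theorem lagrangian_negative {σ : ℕ} (hσ : σ < n) {u : Jet n} (hu : qc (fun l => u l 0) n ≠ 0) :
    lagrangian n (n - σ) (-n) u =
      (1 / 2) * coeff (σ + 1) (jser u 1 ^ 2 * (jser u 0)⁻¹)
        + ((-(1 / 2)) * coeff (n - σ - 1) (refl n (jser u 1) ^ 2 * (refl n (jser u 0))⁻¹)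
        + 1 * coeff (n - 1) (refl n (jser u 0))⁻¹) := by
  have hpot : potential (-n) 1 (fun l => u l 0) =
      - coeff (n - 1) (refl n (vser 1 fun l => u l 0))⁻¹ := by
    rw [← potentialDown_coeff _ (by omega) hu]
    obtain ⟨m, rfl⟩ : ∃ m, n = m + 1 := ⟨n - 1, by omega⟩
    rfl
  have hkin := sum_metric σ hσ.le (fun l => u l 0) (fun l => u l 1) (fun _ => hu)
  rw [if_pos hσ] at hkin
  rw [lagrangian, hpot, hkin, jser_zero, jser_one]
  ring

/-- The upper block of the metric sees q at z = 0, the lower block and the potential see its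
reflection, so each equation equates a coefficient from one end with one from the other. -/
theorem euler_negative {σ : ℕ} (hσ : σ < n) (i : Fin n) {u : Jet n}
    (hu : qc (fun l => u l 0) n ≠ 0) :
    euler i (lagrangian n (n - σ) (-n)) u =
      coeff (σ + 1) (X ^ ((i : ℕ) + 1) *
        (quadVal (jser u 0) (jser u 1) (jser u 2) * (jser u 0)⁻¹ ^ 2))
      - coeff i ((1 + X ^ σ * quadVal (refl n (jser u 0)) (refl n (jser u 1)) (refl n (jser u 2)))
        * (refl n (jser u 0))⁻¹ ^ 2) := by
  have hD0 : ∀ v ∈ {v : Jet n | qc (fun l => v l 0) n ≠ 0},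
      constantCoeff ((LinearMap.id : ℝ⟦X⟧ →ₗ[ℝ] ℝ⟦X⟧) (jser v 0)) ≠ 0 :=
    fun v _ => constantCoeff_jser_zero v
  have hD : ∀ v ∈ {v : Jet n | qc (fun l => v l 0) n ≠ 0},
      constantCoeff (reflLin n (jser v 0)) ≠ 0 := by
    intro v hv
    change constantCoeff (refl n (jser v 0)) ≠ 0
    rwa [jser_zero, constantCoeff_refl_vser, coeff_vser_one]
  have hline : ∀ v ∈ {v : Jet n | qc (fun l => v l 0) n ≠ 0}, ∀ w : Jet n,
      ∀ᶠ t : ℝ in nhds 0, v + t • w ∈ {v : Jet n | qc (fun l => v l 0) n ≠ 0} := by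
    intro v hv w
    have h := (hasSerDeriv_jser LinearMap.id v w 0 n).continuousAt
    simp only [LinearMap.id_apply, jser_zero, coeff_vser_one] at h
    exact h.eventually_ne (by simpa using hv)
  have hE := ((hasEuler_kinetic LinearMap.id hD0 i (σ + 1)).const_mul (1 / 2)).add
    (((hasEuler_kinetic (reflLin n) hD i (n - σ - 1)).const_mul (-(1 / 2))).add
    ((hasEuler_inv (reflLin n) hD i (n - 1)).const_mul 1))
  rw [hE.euler_eq hline (fun v hv => lagrangian_negative hσ hv)
    (fun v k t hk => lagrangian_order _ _ i v k t hk) hu]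
  have hR : ∀ f, reflLin n f = refl n f := fun _ => rfl
  have hu' : constantCoeff (refl n (jser u 0)) ≠ 0 := hD u hu
  simp only [LinearMap.id_apply, hR, refl_X_pow_succ]
  have hi := i.2
  rw [half_smul_kinetic (constantCoeff_jser_zero u), neg_mul, half_smul_kinetic hu', one_mul,
    add_mul, one_mul, map_add, mul_assoc (X ^ σ), coeff_X_pow_mul', coeff_X_pow_mul',
    coeff_X_pow_mul', coeff_X_pow_mul', if_pos (show n - 1 - (i : ℕ) ≤ n - 1 by omega),
    show n - 1 - (n - 1 - (i : ℕ)) = i by omega,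
    show n - σ - 1 - (n - 1 - (i : ℕ)) = i - σ by omega]
  by_cases h : σ ≤ (i : ℕ)
  · rw [if_pos h, if_pos (show n - 1 - (i : ℕ) ≤ n - σ - 1 by omega)]
    ring
  · rw [if_neg h, if_neg (show ¬ n - 1 - (i : ℕ) ≤ n - σ - 1 by omega)]
    ring

end Densities

/-! ### Substituting differential functions: from identities at jets to identities of series. -/

section Substitution

variable {N n : ℕ} {U : Opens (Jet N)}

/-- The jet of a tuple of differential functions. -/
noncomputable def jetOf (E : Fin n → DiffFun U) (u : U) : Jet n :=
  fun i k => ((dx U)^[k] (E i)).1 u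

theorem prolong_eq_jetOf {e : Fin n → Jet N → ℝ} {E : Fin n → DiffFun U}
    (h : ∀ i (u : U), e i u = (E i).1 u) (u : U) : prolong e (u : Jet N) = jetOf E u := by
  funext i k
  exact totalD_iterate (h i) k u

theorem serD_vser {A : Type*} [CommRing A] [Algebra ℝ A] (D : Derivation ℝ A A) (c : A)
    (v : Fin n → A) : serD D (vser c v) = vser (D c) fun i => D (v i) := by
  ext k
  simp only [coeff_serD, vser, coeff_mk]
  split_ifs <;> simp

/-- The generating series of differential functions. -/
noncomputable def genSer (E : Fin n → DiffFun U) : (DiffFun U)⟦X⟧ := vser 1 E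

theorem map_genSer (E : Fin n → DiffFun U) (u : U) :
    PowerSeries.map (evalAt u) (genSer E) = jser (jetOf E u) 0 := by
  rw [genSer, map_vser, map_one, jser_zero]; rfl

theorem map_genSer_one (E : Fin n → DiffFun U) (u : U) :
    PowerSeries.map (evalAt u) (serD (dx U) (genSer E)) = jser (jetOf E u) 1 := by
  rw [genSer, serD_vser, map_vser, Derivation.map_one_eq_zero, map_zero, jser_one]; rfl

theorem map_genSer_two (E : Fin n → DiffFun U) (u : U) :
    PowerSeries.map (evalAt u) (serD (dx U) (serD (dx U) (genSer E))) = jser (jetOf E u) 2 := by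
  rw [genSer, serD_vser, serD_vser, map_vser, Derivation.map_one_eq_zero, map_zero, map_zero,
    jser]
  rfl

theorem map_quad (h : (DiffFun U)⟦X⟧) (u : U) :
    PowerSeries.map (evalAt u) (quad (serD (dx U)) h) =
      quadVal (PowerSeries.map (evalAt u) h) (PowerSeries.map (evalAt u) (serD (dx U) h))
        (PowerSeries.map (evalAt u) (serD (dx U) (serD (dx U) h))) := by
  rw [quad, quadVal, map_sub, map_mul]
  congr 1
  rw [← map_pow (PowerSeries.map (evalAt u))]
  ext k
  rw [coeff_map, PowerSeries.coeff_smul, PowerSeries.coeff_smul, coeff_map]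
  rfl

theorem map_inverse {h y : (DiffFun U)⟦X⟧} (hy : h * y = 1) (u : U) :
    PowerSeries.map (evalAt u) y = (PowerSeries.map (evalAt u) h)⁻¹ := by
  have e : PowerSeries.map (evalAt u) h * PowerSeries.map (evalAt u) y = 1 := by
    rw [← map_mul, hy, map_one]
  have hc : constantCoeff (PowerSeries.map (evalAt u) h) ≠ 0 := by
    intro h0
    have := congrArg constantCoeff e
    rw [map_mul, h0, zero_mul, map_one] at this
    exact zero_ne_one this
  rw [PowerSeries.eq_inv_iff_mul_eq_one hc, mul_comm, e]

theorem isUnit_genSer (E : Fin n → DiffFun U) : IsUnit (genSer E) := by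
  rw [isUnit_iff_constantCoeff, genSer, constantCoeff_vser]
  exact isUnit_one

theorem euler_positive_jetOf (hn : 1 ≤ n) (σ : ℕ) (E : Fin n → DiffFun U)
    {y : (DiffFun U)⟦X⟧} (hy : genSer E * y = 1) (i : Fin n) (u : U) :
    euler i (lagrangian n 0 (2 * n + σ)) (jetOf E u) =
      (coeff (n + σ - i) ((1 + X ^ σ * quad (serD (dx U)) (genSer E)) * y ^ 2)).1 u := by
  have key : PowerSeries.map (evalAt u) ((1 + X ^ σ * quad (serD (dx U)) (genSer E)) * y ^ 2) =
      (1 + X ^ σ * quadVal (jser (jetOf E u) 0) (jser (jetOf E u) 1) (jser (jetOf E u) 2))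
        * (jser (jetOf E u) 0)⁻¹ ^ 2 := by
    simp only [map_mul, map_add, map_one, map_pow, PowerSeries.map_X, map_quad, map_inverse hy,
      map_genSer, map_genSer_one, map_genSer_two]
  rw [euler_positive hn, ← evalAt_apply, ← coeff_map, key]

theorem qc_jetOf (E : Fin n → DiffFun U) (u : U) :
    qc (fun l => jetOf E u l 0) n = (constantCoeff (refl n (genSer E))).1 u := by
  rw [← coeff_vser_one, genSer, constantCoeff_refl_vser, ← evalAt_apply, ← coeff_map, map_vser,
    map_one]
  rfl

theorem euler_negative_jetOf {σ : ℕ} (hσ : σ < n) (E : Fin n → DiffFun U)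
    {y z : (DiffFun U)⟦X⟧} (hy : genSer E * y = 1) (hz : refl n (genSer E) * z = 1)
    (i : Fin n) (u : U) :
    euler i (lagrangian n (n - σ) (-n)) (jetOf E u) =
      (coeff i (cut σ (refl σ (quad (serD (dx U)) (genSer E) * y ^ 2)))
        - coeff i ((1 + X ^ σ * quad (serD (dx U)) (refl n (genSer E))) * z ^ 2)).1 u := by
  have hu : qc (fun l => jetOf E u l 0) n ≠ 0 := by
    rw [qc_jetOf]
    intro h0
    have h1 := congrArg (fun f => (constantCoeff f).1 u) hz
    simp only [map_mul, map_one] at h1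
    change (constantCoeff (refl n (genSer E))).1 u * (constantCoeff z).1 u = 1 at h1
    rw [h0, zero_mul] at h1
    exact zero_ne_one h1
  have hi := i.2
  have e1 : coeff (σ + 1) (X ^ ((i : ℕ) + 1) * (quad (serD (dx U)) (genSer E) * y ^ 2)) =
      coeff i (cut σ (refl σ (quad (serD (dx U)) (genSer E) * y ^ 2))) := by
    rw [coeff_X_pow_mul', coeff_cut, coeff_refl]
    rcases lt_trichotomy (i : ℕ) σ with h | h | h
    · rw [if_pos (by omega), if_pos h, if_pos h.le, show σ + 1 - ((i : ℕ) + 1) = σ - i by omega]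
    -- For i = σ the constant term of S(q) appears; it vanishes since q_0 = 1 is constant. This is
    -- why w has degree below σ.
    · rw [if_pos (by omega), if_neg (by omega), h, Nat.sub_self,
        coeff_zero_eq_constantCoeff_apply, map_mul, constantCoeff_quad, zero_mul]
      rw [genSer, constantCoeff_vser, Derivation.map_one_eq_zero]
    · rw [if_neg (by omega), if_neg (by omega)]
  rw [euler_negative hσ i hu, ← e1, ← evalAt_apply, map_sub, ← coeff_map, ← coeff_map]
  simp only [map_mul, map_add, map_one, map_pow, PowerSeries.map_X, map_quad, map_inverse hy,
    map_inverse hz, serD_refl, map_refl, map_genSer, map_genSer_one, map_genSer_two]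

/-- The reduced fields as differential functions. -/
theorem reducedField_eq (hN : N ≤ n) {e : Fin n → Jet N → ℝ} {E : Fin n → DiffFun U}
    (h : ∀ i (u : U), e i u = (E i).1 u) (r : ℕ) (j : Fin N) (u : U) :
    reducedField hN e r j u =
      (coeff ((j : ℕ) + r) (wron (serD (dx U)) (cut r (genSer E)) (genSer E))).1 u := by
  have key : PowerSeries.map (evalAt u) (wron (serD (dx U)) (cut r (genSer E)) (genSer E)) =
      cut r (jser (jetOf E u) 0) * jser (jetOf E u) 1
        - cut r (jser (jetOf E u) 1) * jser (jetOf E u) 0 := by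
    simp only [wron, map_sub, map_mul, serD_cut, map_cut, map_genSer, map_genSer_one]
  rw [reducedField, killingField, prolong_eq_jetOf h, killingTensor_mulVec, ← jser_zero,
    ← jser_one, ← evalAt_apply, ← coeff_map, key]
  rfl

theorem IsElimination.exists_diffFun {ℒ : Jet n → ℝ} {D : Set (Fin n → ℝ)} {I : Set (Fin n)}
    {e : Fin n → Jet N → ℝ} (h : IsElimination ℒ D I (U : Set (Jet N)) e) :
    ∃ E : Fin n → DiffFun U, (∀ i (u : U), e i u = (E i).1 u) ∧
      (∀ (i : Fin N) (j : Fin n), (i : ℕ) = j → E j = coordFun U i 0) ∧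
      (∀ u : U, (fun i => jetOf E u i 0) ∈ D) ∧
      ∀ i ∈ I, ∀ u : U, euler i ℒ (jetOf E u) = 0 := by
  choose E hE using fun i => (h.differential i).exists_diffFun
  refine ⟨E, hE, fun i j hij => Subtype.ext (funext fun u => ?_), fun u => ?_, fun i hi u => ?_⟩
  · rw [← hE j u, h.retained i j hij u u.2]; rfl
  · have := h.mem_domain u u.2
    simp only [hE] at this
    exact this
  · rw [← prolong_eq_jetOf hE]
    exact h.solves i hi u u.2

theorem isElimination_of_diffFun {ℒ : Jet n → ℝ} {D : Set (Fin n → ℝ)} {I : Set (Fin n)}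
    {E : Fin n → DiffFun U}
    (h1 : ∀ (i : Fin N) (j : Fin n), (i : ℕ) = j → E j = coordFun U i 0)
    (h2 : ∀ u : U, (fun i => jetOf E u i 0) ∈ D)
    (h3 : ∀ i ∈ I, ∀ u : U, euler i ℒ (jetOf E u) = 0) :
    IsElimination ℒ D I (U : Set (Jet N)) fun i => extFun (E i).1 := by
  have hE : ∀ i (u : U), extFun (E i).1 (u : Jet N) = (E i).1 u := fun i u => extFun_apply _ u
  refine ⟨U.isOpen, fun i => isDifferentialFunctionOn_extFun _, fun i j hij u hu => ?_,
    fun u hu => ?_, fun i hi u hu => ?_⟩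
  · rw [hE j ⟨u, hu⟩, h1 i j hij]; rfl
  · have := h2 ⟨u, hu⟩
    have e : (fun i => extFun (E i).1 u) = fun i => jetOf E ⟨u, hu⟩ i 0 :=
      funext fun i => hE i ⟨u, hu⟩
    rwa [e]
  · rw [prolong_eq_jetOf hE ⟨u, hu⟩]
    exact h3 i hi ⟨u, hu⟩

/-- The field of index `i` retained in the elimination. -/
theorem coeff_genSer_retained (hN : N ≤ n) {E : Fin n → DiffFun U}
    (h1 : ∀ (i : Fin N) (j : Fin n), (i : ℕ) = j → E j = coordFun U i 0) (i : Fin N) :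
    coeff ((i : ℕ) + 1) (genSer E) = coordFun U i 0 := by
  have := coeff_vser_succ (1 : DiffFun U) E (Fin.castLE hN i)
  rw [h1 i (Fin.castLE hN i) rfl] at this
  exact this

theorem evolve_coeff_genSer (hN : N ≤ n) {E : Fin n → DiffFun U}
    (h1 : ∀ (i : Fin N) (j : Fin n), (i : ℕ) = j → E j = coordFun U i 0) (r i : ℕ) (hi : 1 ≤ i)
    (hiN : i ≤ N) :
    evolve (fun j : Fin N =>
      coeff ((j : ℕ) + (r + 1)) (wron (serD (dx U)) (cut (r + 1) (genSer E)) (genSer E)))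
      (coeff i (genSer E)) =
      coeff (i + r) (wron (serD (dx U)) (cut (r + 1) (genSer E)) (genSer E)) := by
  obtain ⟨k, rfl⟩ : ∃ k, i = k + 1 := ⟨i - 1, by omega⟩
  rw [coeff_genSer_retained hN h1 ⟨k, hiN⟩, evolve_coordFun]
  simp only
  rw [show k + (r + 1) = k + 1 + r by ring]

end Substitution

/-! ### Commutation of the reduced fields and existence of eliminations. -/

section Main

variable {σ α s n : ℕ}

theorem positive_reduced_commute (hσ : 1 ≤ σ) (hn : n + 1 = s + σ + α)
    (hN : σ + α ≤ n) {U : Opens (Jet (σ + α))} {e : Fin n → Jet (σ + α) → ℝ}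
    (he : IsPositiveElimination n σ α (U : Set (Jet (σ + α))) e) {r₁ r₂ : ℕ}
    (hr₁ : r₁ ∈ Set.Icc 1 s) (hr₂ : r₂ ∈ Set.Icc 1 s) (j : Fin (σ + α)) (u : U) :
    fieldCommutator (reducedField hN e r₁) (reducedField hN e r₂) j u = 0 := by
  obtain ⟨E, hE, hret, -, hsol⟩ := IsElimination.exists_diffFun he
  obtain ⟨y, hy⟩ := (isUnit_genSer E).exists_right_inv
  set W := (1 + X ^ σ * quad (serD (dx U)) (genSer E)) * y ^ 2 with hW
  have hcoef : ∀ k, σ + α < k → k ≤ n → coeff k W = 0 := by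
    intro k h1 h2
    refine Subtype.ext (funext fun u => ?_)
    -- The equation of zero-based index i is the coefficient of order n + σ - i, so the range of
    -- equations is N < k ≤ n.
    have := hsol ⟨n + σ - k, by omega⟩ ⟨by simp only; omega, by simp only; omega⟩ u
    rw [euler_positive_jetOf (by omega) σ E hy] at this
    simp only [Nat.sub_sub_self (show k ≤ n + σ by omega)] at this
    exact this
  have hdvd : X ^ (n + 1) ∣ W - cut (σ + α + 1) W := by
    rw [X_pow_dvd_iff]
    intro k hk
    rw [map_sub, coeff_cut]
    split_ifs with h
    · exact sub_self _
    · rw [hcoef k (by omega) (by omega), sub_zero]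
  have heq : X ^ (n + 1) ∣ 1 + X ^ σ * quad (serD (dx U)) (genSer E)
      - cut (σ + α + 1) W * genSer E ^ 2 := by
    have e1 : W * genSer E ^ 2 = 1 + X ^ σ * quad (serD (dx U)) (genSer E) := by
      rw [hW, mul_assoc, ← mul_pow, mul_comm y, hy, one_pow, mul_one]
    rw [← e1, ← sub_mul]
    exact hdvd.mul_right _
  obtain ⟨a₁, rfl⟩ : ∃ a, r₁ = a + 1 := ⟨r₁ - 1, by have := hr₁.1; omega⟩
  obtain ⟨a₂, rfl⟩ : ∃ a, r₂ = a + 1 := ⟨r₂ - 1, by have := hr₂.1; omega⟩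
  refine fieldCommutator_eq_zero (reducedField_eq hN hE (a₁ + 1)) (reducedField_eq hN hE (a₂ + 1))
    j ?_ u
  rw [← coeff_genSer_retained hN hret j]
  exact positive_commute (dx U) _ _ (evolve_dx _) (evolve_dx _) hσ (Nat.le_add_right σ α)
    (by omega) (Nat.lt_of_succ_le hr₁.2) (Nat.lt_of_succ_le hr₂.2) (DegLT.cut _ W)
    (by rw [genSer, constantCoeff_vser]) heq (evolve_coeff_genSer hN hret a₁)
    (evolve_coeff_genSer hN hret a₂) _ (Nat.succ_le_of_lt j.2)

theorem negative_reduced_commute (hσ : 1 ≤ σ) (hs : 1 ≤ s) (hn : n + 1 = s + 2 * (σ + α))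
    (hN : σ + α ≤ n) {U : Opens (Jet (σ + α))} {e : Fin n → Jet (σ + α) → ℝ}
    (he : IsNegativeElimination n σ α (U : Set (Jet (σ + α))) e) {r₁ r₂ : ℕ}
    (hr₁ : r₁ ∈ Set.Icc (σ + α + 1) (σ + α + s)) (hr₂ : r₂ ∈ Set.Icc (σ + α + 1) (σ + α + s))
    (j : Fin (σ + α)) (u : U) :
    fieldCommutator (reducedField hN e r₁) (reducedField hN e r₂) j u = 0 := by
  obtain ⟨E, hE, hret, hdom, hsol⟩ := IsElimination.exists_diffFun he
  obtain ⟨y, hy⟩ := (isUnit_genSer E).exists_right_inv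
  have hQu : IsUnit (refl n (genSer E)) := by
    rw [isUnit_iff_constantCoeff]
    obtain ⟨g, hg⟩ := exists_mul_eq_one (g := constantCoeff (refl n (genSer E)))
      (fun u => by rw [← qc_jetOf]; exact hdom u)
    exact IsUnit.of_mul_eq_one g hg
  obtain ⟨z, hz⟩ := hQu.exists_right_inv
  set W := quad (serD (dx U)) (genSer E) * y ^ 2 with hW
  set V := (1 + X ^ σ * quad (serD (dx U)) (refl n (genSer E))) * z ^ 2 with hV
  have hdvd : X ^ (n - (σ + α)) ∣ V - cut σ (refl σ W) := by
    rw [X_pow_dvd_iff]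
    intro k hk
    refine Subtype.ext (funext fun u => ?_)
    have := hsol ⟨k, by omega⟩ (by change k + 1 + (σ + α) ≤ n; omega) u
    rw [euler_negative_jetOf (by omega) E hy hz] at this
    rw [map_sub, ← neg_sub]
    exact neg_eq_zero.2 this
  have heq : X ^ (n - (σ + α)) ∣ 1 + X ^ σ * quad (serD (dx U)) (refl n (genSer E))
      - cut σ (refl σ W) * refl n (genSer E) ^ 2 := by
    have e1 : V * refl n (genSer E) ^ 2 =
        1 + X ^ σ * quad (serD (dx U)) (refl n (genSer E)) := by
      rw [hV, mul_assoc, ← mul_pow, mul_comm z, hz, one_pow, mul_one]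
    rw [← e1, ← sub_mul]
    exact hdvd.mul_right _
  obtain ⟨a₁, rfl⟩ : ∃ a, r₁ = a + 1 := ⟨r₁ - 1, by have := hr₁.1; omega⟩
  obtain ⟨a₂, rfl⟩ : ∃ a, r₂ = a + 1 := ⟨r₂ - 1, by have := hr₂.1; omega⟩
  refine fieldCommutator_eq_zero (reducedField_eq hN hE (a₁ + 1)) (reducedField_eq hN hE (a₂ + 1))
    j ?_ u
  rw [← coeff_genSer_retained hN hret j]
  refine negative_commute (dx U) _ _ (evolve_dx _) (evolve_dx _) (r₁ := a₁ + 1) (r₂ := a₂ + 1)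
    (W := W) (q := genSer E) hσ (Nat.le_add_right σ α)
    hn (Nat.lt_of_succ_le hr₁.1) hr₁.2 (Nat.lt_of_succ_le hr₂.1) hr₂.2
    (DegLT.cut _ (refl σ W)) hs
    (by rw [genSer, constantCoeff_vser]) (degLT_vser _ _) (fun k hk => ?_) hQu heq ?_
    (fun k hk => ?_) (evolve_coeff_genSer hN hret a₁)
    (evolve_coeff_genSer hN hret a₂) _ (Nat.succ_le_of_lt j.2)
  · rw [coeff_refl, if_pos hk]
  · rw [hW, mul_assoc, ← mul_pow, mul_comm y, hy, one_pow, mul_one]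
  · rw [coeff_cut, coeff_refl, if_pos hk, if_pos hk.le]

/-- The coefficients of (1 + z^σ S(q)) / q² up to z^N depend on the retained fields only. They
define w, and the further coefficients of its exact solution h are the eliminated fields. -/
theorem exists_positive_elimination (hσ : 1 ≤ σ) (hs : 1 ≤ s) (hn : n + 1 = s + σ + α) :
    ∃ e : Fin n → Jet (σ + α) → ℝ, IsPositiveElimination n σ α Set.univ e := by
  set U : Opens (Jet (σ + α)) := ⊤
  set D := serD (dx U) with hD
  set q₀ : (DiffFun U)⟦X⟧ := genSer fun i => coordFun U i 0 with hq₀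
  have hc0 : constantCoeff q₀ = 1 := by rw [hq₀, genSer, constantCoeff_vser]
  obtain ⟨y₀, hy₀⟩ := (isUnit_genSer fun i => coordFun U i 0).exists_right_inv
  rw [← hq₀] at hy₀
  set w := cut (σ + α + 1) ((1 + X ^ σ * quad D q₀) * y₀ ^ 2) with hw
  have e₀ : X ^ (σ + α + 1) ∣ 1 + X ^ σ * quad D q₀ - w * q₀ ^ 2 := by
    have e1 : (1 + X ^ σ * quad D q₀) * y₀ ^ 2 * q₀ ^ 2 = 1 + X ^ σ * quad D q₀ := by
      rw [mul_assoc, ← mul_pow, mul_comm y₀, hy₀, one_pow, mul_one]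
    conv_rhs => rw [← e1]
    rw [← sub_mul]
    exact (X_pow_dvd_sub_cut _ _).mul_right _
  have hw0 : constantCoeff w = 1 := by
    have := X_pow_dvd_iff.1 e₀ 0 (by omega)
    rw [coeff_zero_eq_constantCoeff_apply] at this
    simp [show σ ≠ 0 by omega, hc0] at this
    linear_combination -this
  obtain ⟨h, hh0, hh⟩ := exists_solution (dx U) hσ w 1 (by rw [hw0]; ring)
  have hcong : X ^ (σ + α + 1) ∣ q₀ - h := by
    refine solution_congr (dx U) hσ (w := w) ?_ ?_ e₀ ?_
    · rw [isUnit_iff_constantCoeff, map_mul, hw0, hc0]; simp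
    · rw [X_dvd_iff, map_sub, hc0, hh0, sub_self]
    · rw [hh, sub_self]; exact dvd_zero _
  set E : Fin n → DiffFun U := fun i => coeff ((i : ℕ) + 1) h with hEdef
  have hqh : X ^ (n + 1) ∣ genSer E - h := by
    rw [X_pow_dvd_iff]
    intro k hk
    rw [map_sub, sub_eq_zero]
    rcases Nat.eq_zero_or_pos k with rfl | hk0
    · rw [genSer, coeff_vser_zero, coeff_zero_eq_constantCoeff_apply, hh0]
    · obtain ⟨l, rfl⟩ : ∃ l, k = l + 1 := ⟨k - 1, by omega⟩
      exact coeff_vser_succ (1 : DiffFun U) E ⟨l, by omega⟩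
  obtain ⟨y, hy⟩ := (isUnit_genSer E).exists_right_inv
  have hW : X ^ (n + 1) ∣ (1 + X ^ σ * quad D (genSer E)) * y ^ 2 - w := by
    have h1 := (X_pow_dvd_quad_sub (dx U) hqh).mul_left (X ^ σ)
    have h2 := hqh.mul_right (w * (genSer E + h))
    convert (dvd_sub h1 h2).mul_right (y ^ 2) using 1
    linear_combination (w * (genSer E * y + 1)) * hy + y ^ 2 * hh
  refine ⟨fun i => extFun (E i).1, ?_⟩
  refine isElimination_of_diffFun (U := U) (fun i j hij => ?_) (fun u => Set.mem_univ _)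
    fun i hi u => ?_
  · have h1 := X_pow_dvd_iff.1 hcong ((i : ℕ) + 1) (by have := i.2; omega)
    rw [map_sub, sub_eq_zero] at h1
    rw [hEdef]
    simp only
    rw [← hij, ← h1, hq₀]
    exact coeff_vser_succ (1 : DiffFun U) _ i
  · rw [euler_positive_jetOf (by omega) σ E hy]
    have h1 := hi.1
    have h2 := hi.2
    have := X_pow_dvd_iff.1 hW (n + σ - i) (by omega)
    rw [map_sub, hw, coeff_cut, if_neg (by omega), sub_zero] at this
    rw [this]
    rfl

theorem continuous_diffFun {N : ℕ} {U : Opens (Jet N)} (g : DiffFun U) : Continuous g.1 := by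
  obtain ⟨K, F, hF, h⟩ := g.2
  have ht : Continuous fun u : U => truncJet K (u : Jet N) := by
    exact continuous_pi fun i => continuous_pi fun k =>
      (continuous_apply (k : ℕ)).comp ((continuous_apply i).comp continuous_subtype_val)
  rw [show g.1 = fun u : U => F (truncJet K (u : Jet N)) from funext h]
  exact hF.continuousOn.comp_continuous ht fun u => ⟨u, u.2, rfl⟩

/-- The leading coefficient `[z^σ] (q_x² / 2 - q q_xx) / q²` of the potential. -/
noncomputable def leadCoeff {N : ℕ} (σ : ℕ) (u : Jet N) : ℝ :=
  coeff σ (quadVal (jser u 0) (jser u 1) (jser u 2) * (jser u 0)⁻¹ ^ 2)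

theorem leadCoeff_eq {N : ℕ} {U : Opens (Jet N)} {y : (DiffFun U)⟦X⟧}
    (hy : genSer (fun i => coordFun U i 0) * y = 1) (σ : ℕ) (u : U) :
    leadCoeff σ (u : Jet N) =
      (coeff σ (quad (serD (dx U)) (genSer fun i => coordFun U i 0) * y ^ 2)).1 u := by
  have hjet : jetOf (fun i => coordFun U i 0) u = (u : Jet N) := by
    funext i k
    rw [jetOf, dx_iterate_coordFun]
    rfl
  rw [← evalAt_apply, ← coeff_map, map_mul, map_quad, map_pow, map_inverse hy, map_genSer,
    map_genSer_one, map_genSer_two, hjet, leadCoeff]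

theorem isOpen_leadCoeff_pos {N : ℕ} (σ : ℕ) : IsOpen {u : Jet N | 0 < leadCoeff σ u} := by
  obtain ⟨y, hy⟩ := (isUnit_genSer fun i : Fin N => coordFun ⊤ i 0).exists_right_inv
  obtain ⟨g, hg⟩ : ∃ g : DiffFun (⊤ : Opens (Jet N)),
      ∀ u : (⊤ : Opens (Jet N)), leadCoeff σ (u : Jet N) = g.1 u := ⟨_, leadCoeff_eq hy σ⟩
  have hm : ∀ u : Jet N, u ∈ (⊤ : Opens (Jet N)) := Opens.mem_top
  have : Continuous (leadCoeff σ : Jet N → ℝ) := by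
    have e : (leadCoeff σ : Jet N → ℝ) = fun u => g.1 ⟨u, hm u⟩ := funext fun u => hg ⟨u, hm u⟩
    rw [e]
    exact (continuous_diffFun g).comp (continuous_id.subtype_mk hm)
  exact isOpen_lt continuous_const this

theorem exists_leadCoeff_pos {N : ℕ} (hσ : 1 ≤ σ) (hσN : σ ≤ N) :
    ∃ u : Jet N, 0 < leadCoeff σ u := by
  set i : Fin N := ⟨σ - 1, by omega⟩ with hi
  -- At q = 1, q_x = 0, q_xx = -z^σ one has S(q) = z^σ, so the leading coefficient is 1.
  set u : Jet N := fun j k => if j = i ∧ k = 2 then -1 else 0 with hu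
  refine ⟨u, ?_⟩
  have e0 : jser u 0 = 1 := by
    have : (fun j => u j 0) = 0 := by funext j; simp [hu]
    rw [jser_zero, this]
    ext k
    simp [vser, coeff_one]
  have e1 : jser u 1 = 0 := by
    have : (fun j => u j 1) = 0 := by funext j; simp [hu]
    rw [jser_one, this, vser_zero]
  have e2 : jser u 2 = - X ^ σ := by
    have : (fun j => u j 2) = 0 + (-1 : ℝ) • Pi.single i (1 : ℝ) := by
      funext j
      by_cases hj : j = i
      · subst hj; simp [hu]
      · simp [hu, hj]
    rw [jser, if_neg (by norm_num), this, vser_add_smul, vser_zero, vser_single, hi]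
    simp only [Nat.sub_add_cancel hσ]
    simp
  have hinv : (1 : ℝ⟦X⟧)⁻¹ = 1 := by
    have := PowerSeries.mul_inv_cancel (1 : ℝ⟦X⟧) (by simp)
    rwa [one_mul] at this
  rw [leadCoeff, e0, e1, e2, quadVal, hinv]
  simp [coeff_X_pow]

/-- As σ ≤ N, the polynomial w depends on retained fields only. The condition h(0)² w(0) = 1 forces
w(0) > 0, whence the open set on which `leadCoeff` is positive. -/
theorem exists_negative_elimination (hσ : 1 ≤ σ) (hs : 1 ≤ s)
    (hn : n + 1 = s + 2 * (σ + α)) :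
    ∃ (U : Set (Jet (σ + α))) (e : Fin n → Jet (σ + α) → ℝ),
      U.Nonempty ∧ IsNegativeElimination n σ α U e := by
  set U : Opens (Jet (σ + α)) := ⟨_, isOpen_leadCoeff_pos σ⟩ with hU
  set D := serD (dx U) with hD
  set q₀ : (DiffFun U)⟦X⟧ := genSer fun i => coordFun U i 0 with hq₀
  obtain ⟨y₀, hy₀⟩ := (isUnit_genSer fun i => coordFun U i 0).exists_right_inv
  have hpos : ∀ u : U, 0 < (coeff σ (quad D q₀ * y₀ ^ 2)).1 u := by
    intro u
    rw [← leadCoeff_eq hy₀]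
    exact u.2
  rw [← hq₀] at hy₀
  obtain ⟨a, ha⟩ := exists_sq_mul_eq_one hpos
  set w := cut σ (refl σ (quad D q₀ * y₀ ^ 2)) with hw
  have hw0 : constantCoeff w = coeff σ (quad D q₀ * y₀ ^ 2) := by
    rw [← coeff_zero_eq_constantCoeff_apply, hw, coeff_cut, coeff_refl, if_pos (by omega),
      if_pos (by omega), Nat.sub_zero]
  obtain ⟨h, hh0, hh⟩ := exists_solution (dx U) hσ w a (by rw [hw0, ha])
  -- The eliminated fields are read from h backwards, q_j being its coefficient of order n - j. In
  -- particular q_n = h(0) = a, which is nowhere zero.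
  set E : Fin n → DiffFun U := fun i =>
    if hi : (i : ℕ) < σ + α then coordFun U ⟨i, hi⟩ 0 else coeff (n - 1 - i) h with hEdef
  have hq : X ^ (σ + α + 1) ∣ genSer E - q₀ := by
    rw [X_pow_dvd_iff]
    intro k hk
    rw [map_sub, sub_eq_zero, hq₀, genSer, genSer]
    rcases Nat.eq_zero_or_pos k with rfl | hk0
    · rw [coeff_vser_zero, coeff_vser_zero]
    · obtain ⟨l, rfl⟩ : ∃ l, k = l + 1 := ⟨k - 1, by omega⟩
      have e1 := coeff_vser_succ (1 : DiffFun U) E ⟨l, by omega⟩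
      have e2 := coeff_vser_succ (1 : DiffFun U) (fun i => coordFun U i 0)
        (⟨l, by omega⟩ : Fin (σ + α))
      simp only at e1 e2
      rw [e1, e2, hEdef]
      simp only
      rw [dif_pos (by omega)]
  have hQ : X ^ (n - (σ + α)) ∣ refl n (genSer E) - h := by
    rw [X_pow_dvd_iff]
    intro k hk
    rw [map_sub, sub_eq_zero, coeff_refl, if_pos (by omega), genSer]
    have e1 := coeff_vser_succ (1 : DiffFun U) E ⟨n - k - 1, by omega⟩
    simp only at e1
    rw [Nat.sub_add_cancel (by omega)] at e1
    rw [e1, hEdef]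
    simp only
    rw [dif_neg (by omega), show n - 1 - (n - k - 1) = k by omega]
  obtain ⟨y, hy⟩ := (isUnit_genSer E).exists_right_inv
  have hQ0 : constantCoeff (refl n (genSer E)) = a := by
    have := X_pow_dvd_iff.1 hQ 0 (by omega)
    rw [map_sub, sub_eq_zero, coeff_zero_eq_constantCoeff_apply,
      coeff_zero_eq_constantCoeff_apply, hh0] at this
    exact this
  have hau : IsUnit a := IsUnit.of_mul_eq_one (a * coeff σ (quad D q₀ * y₀ ^ 2)) (by
    rw [← ha]; ring)
  obtain ⟨z, hz⟩ := (isUnit_iff_constantCoeff.2 (hQ0 ▸ hau :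
    IsUnit (constantCoeff (refl n (genSer E))))).exists_right_inv
  have hA : X ^ (σ + α + 1) ∣ quad D (genSer E) * y ^ 2 - quad D q₀ * y₀ ^ 2 := by
    have h1 := (X_pow_dvd_quad_sub (dx U) hq).mul_right (y ^ 2)
    have h2 := hq.mul_left (quad D q₀ * (y + y₀) * y * y₀)
    convert dvd_sub h1 h2 using 1
    linear_combination (quad D q₀ * (y + y₀) * y₀) * hy - (quad D q₀ * (y + y₀) * y) * hy₀
  -- Consistency: the full q, eliminated fields included, yields the same w, since w sees q only mod
  -- z^(σ+1).
  have hwE : cut σ (refl σ (quad D (genSer E) * y ^ 2)) = w := by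
    ext1 k
    rw [hw, coeff_cut, coeff_cut]
    split_ifs with hk
    · rw [coeff_refl, coeff_refl, if_pos hk.le, if_pos hk.le, ← sub_eq_zero, ← map_sub]
      exact X_pow_dvd_iff.1 hA _ (by omega)
    · rfl
  have hW : X ^ (n - (σ + α)) ∣ (1 + X ^ σ * quad D (refl n (genSer E))) * z ^ 2 - w := by
    have h1 := (X_pow_dvd_quad_sub (dx U) hQ).mul_left (X ^ σ)
    have h2 := hQ.mul_right (w * (refl n (genSer E) + h))
    convert (dvd_sub h1 h2).mul_right (z ^ 2) using 1
    linear_combination (w * (refl n (genSer E) * z + 1)) * hz + z ^ 2 * hh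
  refine ⟨U, fun i => extFun (E i).1, exists_leadCoeff_pos hσ (Nat.le_add_right σ α), ?_⟩
  refine isElimination_of_diffFun (U := U) (fun i j hij => ?_) (fun u => ?_)
    fun i hi u => ?_
  · rw [hEdef]
    simp only
    rw [dif_pos (by have := i.2; omega)]
    congr 1
    exact Fin.ext hij.symm
  · change qc (fun i => jetOf E u i 0) n ≠ 0
    rw [qc_jetOf, hQ0]
    intro h0
    have := congrArg (fun f : DiffFun U => f.1 u) ha
    change a.1 u ^ 2 * _ = 1 at this
    rw [h0] at this
    simp at this
  · rw [euler_negative_jetOf (by omega) E hy hz, ← hD, hwE]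
    have h1 : (i : ℕ) + 1 + (σ + α) ≤ n := hi
    have := X_pow_dvd_iff.1 hW i (by omega)
    rw [map_sub] at this
    rw [← neg_sub, this]
    simp

end Main
end KillingReduction

open KillingReduction

theorem mainTheorem8 (σ α s : ℕ) (hσ : 1 ≤ σ) (hs : 1 ≤ s) :
    -- positive potentials (`α = 0` is the basic reduction), `n = s + σ + α - 1`
    (∀ (n : ℕ) (hn : n + 1 = s + σ + α),
      (∃ e : Fin n → Jet (σ + α) → ℝ, IsPositiveElimination n σ α Set.univ e) ∧
      ∀ (U : Set (Jet (σ + α))) (e : Fin n → Jet (σ + α) → ℝ),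
        IsPositiveElimination n σ α U e →
        ∀ r₁ ∈ Set.Icc 1 s, ∀ r₂ ∈ Set.Icc 1 s, ∀ u ∈ U, ∀ j : Fin (σ + α),
          fieldCommutator (reducedField (show σ + α ≤ n by omega) e r₁)
            (reducedField (show σ + α ≤ n by omega) e r₂) j u = 0) ∧
    -- negative potentials (`α = 0` is the basic reduction), `n = s + 2 (σ + α) - 1`
    (∀ (n : ℕ) (hn : n + 1 = s + 2 * (σ + α)),
      (∃ (U : Set (Jet (σ + α))) (e : Fin n → Jet (σ + α) → ℝ),
        U.Nonempty ∧ IsNegativeElimination n σ α U e) ∧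
      ∀ (U : Set (Jet (σ + α))) (e : Fin n → Jet (σ + α) → ℝ),
        IsNegativeElimination n σ α U e →
        ∀ r₁ ∈ Set.Icc (σ + α + 1) (σ + α + s), ∀ r₂ ∈ Set.Icc (σ + α + 1) (σ + α + s),
          ∀ u ∈ U, ∀ j : Fin (σ + α),
          fieldCommutator (reducedField (show σ + α ≤ n by omega) e r₁)
            (reducedField (show σ + α ≤ n by omega) e r₂) j u = 0) := by
  refine ⟨fun n hn => ⟨exists_positive_elimination hσ hs hn, ?_⟩,
    fun n hn => ⟨exists_negative_elimination hσ hs hn, ?_⟩⟩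
  · intro U e he r₁ hr₁ r₂ hr₂ u hu j
    exact positive_reduced_commute (U := ⟨U, he.isOpen⟩) hσ hn _ he hr₁ hr₂ j ⟨u, hu⟩
  · intro U e he r₁ hr₁ r₂ hr₂ u hu j
    exact negative_reduced_commute (U := ⟨U, he.isOpen⟩) hσ hs hn _ he hr₁ hr₂ j ⟨u, hu⟩
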